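/- Let $R>0$ and let $B_R=\{x\in\mathbb R^3:|x|\le R\}$. For a real-valued $f\in L^2(\mathbb R^3)$ that vanishes outside $B_R$ and for $\kappa>0$, let $u(\cdot,\kappa)$ be the outgoing solution of $$\Delta^2u-\kappa^4u=f\quad\text{in }\mathbb R^3,\qquad \lim_{r\to\infty}r(\partial_ru-\mathrm i\kappa u)=0,\quad \lim_{r\to\infty}r\big(\partial_r(\Delta u)-\mathrm i\kappa\,\Delta u\big)=0$$ uniformly in all directions, where $r=|x|$. (The equation holds in the sense of distributions, and $u$ is the $C^2$ representative.) Put $$F(\kappa):=\kappa^4\|u(\cdot,\kappa)\|^2_{L^2(\partial B_R)}+\kappa^2\|\Delta u(\cdot,\kappa)\|^2_{L^2(\partial B_R)}.$$ Let $\varepsilon>0$, $A>0$ and $A_1:=A+\varepsilon$. Then there is a function $\beta$ on $(A_1,\infty)$, not depending on $f$, with $$\beta(\kappa)\ge\tfrac12\ \text{ for }\kappa\in(A_1,\ \varepsilon+2^{1/4}A),\qquad \beta(\kappa)\ge\frac1\pi\Big(\Big(\frac{\kappa-\varepsilon}{A}\Big)^4-1\Big)^{-1/2}\ \text{ for }\kappa\in(\varepsilon+2^{1/4}A,\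 \infty),$$ such that the following holds. For every $Q_0>0$ there is a constant $C>0$, depending only on $R,\varepsilon,A,Q_0$ and $\beta$, such that for every $Q\ge Q_0$ and every such $f$ with $\|f\|_{L^2(B_R)}\le Q$, the number $\epsilon_1^2:=\sup_{\kappa\in(\varepsilon,A_1)}F(\kappa)$ is finite (with $\epsilon_1\ge 0$) and $$F(\kappa)\le C\,Q^2\,e^{6R\kappa}\,\epsilon_1^{2\beta(\kappa)}\qquad\text{for all }\kappa\in(A_1,\infty).$$ -/

import Mathlib

open MeasureTheory Filter Topology Laplacian
open scoped ContDiff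

/-- Three-dimensional Euclidean space. -/
abbrev E3 : Type := EuclideanSpace ℝ (Fin 3)

/-- The Sommerfeld radiation condition `r (∂_r v - i κ v) → 0` as `r = |x| → ∞`, uniformly in all
directions `x / |x|`. The limit along `Bornology.cobounded E3` is the uniform limit; the function
is required to be differentiable near infinity, so that the radial derivative has its meaning. -/
def RadiationCondition (κ : ℝ) (v : E3 → ℂ) : Prop :=
  (∀ᶠ x in Bornology.cobounded E3, DifferentiableAt ℝ v x) ∧
  Tendsto (fun x : E3 =>
      (‖x‖ : ℂ) * (fderiv ℝ v x (‖x‖⁻¹ • x) - Complex.I * (κ : ℂ) * v x))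
    (Bornology.cobounded E3) (𝓝 0)

/-- `u` solves the scattering problem for the biharmonic operator without potential:
`Δ² u - κ⁴ u = f` in `ℝ³` in the sense of distributions, and both `u` and `Δ u` satisfy the
radiation condition. Solutions with a source in `L²` are locally in `H⁴`, which embeds in `C²`; `u`
is the `C²` representative, so that `u` and `Δ u` have pointwise values on spheres. -/
structure IsScatteringSolution (f : E3 → ℝ) (κ : ℝ) (u : E3 → ℂ) : Prop where
  contDiff : ContDiff ℝ 2 u
  equation : ∀ φ : E3 → ℝ, ContDiff ℝ ∞ φ → HasCompactSupport φ →
    ∫ x, u x * ((Δ (Δ φ) x - κ ^ 4 * φ x : ℝ) : ℂ) = ((∫ x, f x * φ x : ℝ) : ℂ)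
  radiation : RadiationCondition κ u
  radiation_laplacian : RadiationCondition κ (Δ u)

/-- The square `‖g‖²_{L²(∂B_R)}` of the `L²` norm over the sphere of radius `R` about the origin,
with respect to surface measure (that of the unit sphere, `volume.toSphere`, times `R²`). -/
noncomputable def sphereNormSq (R : ℝ) (g : E3 → ℂ) : ℝ :=
  R ^ 2 * ∫ s : Metric.sphere (0 : E3) 1, ‖g (R • (s : E3))‖ ^ 2 ∂(volume : Measure E3).toSphere

/-- The boundary data `κ⁴ ‖u(·,κ)‖²_{L²(∂B_R)} + κ² ‖Δu(·,κ)‖²_{L²(∂B_R)}` at wavenumber `κ`. -/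
noncomputable def boundaryData (R : ℝ) (u : ℝ → E3 → ℂ) (κ : ℝ) : ℝ :=
  κ ^ 4 * sphereNormSq R (u κ) + κ ^ 2 * sphereNormSq R (Δ (u κ))

/-- The size `ε₁` of the low-wavenumber data: `ε₁²` is the supremum of the boundary data over
`κ ∈ (a, b)`. -/
noncomputable def dataLevel (R : ℝ) (u : ℝ → E3 → ℂ) (a b : ℝ) : ℝ :=
  Real.sqrt (sSup (boundaryData R u '' Set.Ioo a b))

/-! The boundary data extend to an entire function of the wavenumber, and smallness on a short
interval spreads along the positive axis by a two-constants estimate in a sector.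

Since `Δ² - κ⁴ = (Δ + κ²)(Δ - κ²)`, the functions `Δu - κ²u` and `Δu + κ²u` solve second-order
equations with source `f`. Both inherit the outgoing condition, and `eq_neg_pot` identifies them
with minus the potentials of `f` with kernels `e^{iκr}/(4πr)` and `e^{-κr}/(4πr)`. Hence `u` and
`Δu` are explicit combinations of `pot f x (iκ)` and `pot f x (-κ)`
(`IsScatteringSolution.representation`). The potential is entire in its parameter, and as `f` is
real, conjugation for real `κ` only replaces `iκ` by `-iκ`. So `F` is the restriction of the entire
function `boundaryExt`.

In the sector `|Im k| ≤ Re k` each potential is at most a multiple of `Q e^{2R Re k}` on the sphere,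
so `e^{-6Rk}` times the extension is bounded there by a multiple of `Q²`
(`norm_exp_mul_boundaryExt_le`). On the slit `(ε, A + ε)` it is bounded by `ε₁²`. The map `s ↦ ε + A
sin(πs/2)^{-1/2}` carries the strip `0 < Re s < 1` onto the sector with vertex `ε` minus the slit,
with `Re s = 1` going to the slit and `s = β(κ)` to `κ`. Hadamard's three lines theorem then gives
the exponent `β(κ) = (2/π) arcsin((A/(κ-ε))²)`, the harmonic measure of the slit seen from `κ`
(`norm_le_of_bound_on_slit`).

For `eq_neg_pot`, the weak equation is tested with the kernel cut off near `x₀` and near infinity.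
The inner cutoff produces the value at `x₀`. The outer one leaves an error that is integrated by
parts twice along rays, using the nonzero combined phase `l + iκ` (`norm_radial_tail_le`); this
requires only `w = o(r)`. -/

/-! ### Complex analysis: the slit sector, two constants, and analytic parameter integrals. -/

lemma abs_im_le_re_of_sq_re_nonneg {v : ℂ} (h : 0 ≤ v.re) (h2 : 0 ≤ (v ^ 2).re) :
    |v.im| ≤ v.re := by
  have : (v ^ 2).re = v.re ^ 2 - v.im ^ 2 := by rw [pow_two, Complex.mul_re]; ring
  exact abs_le_of_sq_le_sq (by linarith) h

/-- The power has argument `-arg z / 2`, so its real part is nonnegative, and its square `1/z` again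
lies in the right half-plane. -/
lemma cpow_neg_half_sector {z : ℂ} (hz : 0 < z.re) :
    |(z ^ (-(1 / 2) : ℂ)).im| ≤ (z ^ (-(1 / 2) : ℂ)).re := by
  have hz0 : z ≠ 0 := by rintro rfl; simp at hz
  apply abs_im_le_re_of_sq_re_nonneg
  · rw [Complex.cpow_def_of_ne_zero hz0, Complex.exp_re]
    refine mul_nonneg (Real.exp_pos _).le (Real.cos_nonneg_of_mem_Icc ?_)
    have h1 := Complex.neg_pi_lt_arg z
    have h2 := Complex.arg_le_pi z
    have : (Complex.log z * (-(1 / 2) : ℂ)).im = -(z.arg / 2) := by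
      rw [Complex.mul_im]
      simp [Complex.log_im]; ring
    rw [this]
    constructor <;> linarith
  · have : (z ^ (-(1 / 2) : ℂ)) ^ 2 = z⁻¹ := by
      rw [← Complex.cpow_nat_mul]
      norm_num
      rw [Complex.cpow_neg_one]
    rw [this, Complex.inv_re]
    exact div_nonneg hz.le (Complex.normSq_nonneg _)

lemma sin_half_pi_mul_re (s : ℂ) :
    (Complex.sin (Real.pi / 2 * s)).re =
      Real.sin (Real.pi / 2 * s.re) * Real.cosh (Real.pi / 2 * s.im) := by
  have : (Real.pi / 2 * s : ℂ) = ((Real.pi / 2 * s.re : ℝ) : ℂ)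
      + ((Real.pi / 2 * s.im : ℝ) : ℂ) * Complex.I := by
    conv_lhs => rw [← Complex.re_add_im s]
    push_cast; ring
  rw [this, Complex.sin_add_mul_I]
  simp only [← Complex.ofReal_sin, ← Complex.ofReal_cos, ← Complex.ofReal_cosh,
    ← Complex.ofReal_sinh, Complex.add_re, ← Complex.ofReal_mul, Complex.ofReal_re,
    Complex.re_ofReal_mul, Complex.I_re, mul_zero, add_zero]

/-- The conformal map of a strip onto a slit sector of opening `π / 2` with vertex `ε`. -/
noncomputable def stripToSector (ε A : ℝ) (s : ℂ) : ℂ :=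
  ε + A * (Complex.sin (Real.pi / 2 * s)) ^ (-(1 / 2) : ℂ)

lemma sin_half_pi_mul_re_pos {s : ℂ} (h0 : 0 < s.re) (h1 : s.re ≤ 1) :
    0 < (Complex.sin (Real.pi / 2 * s)).re := by
  rw [sin_half_pi_mul_re]
  have := Real.pi_pos
  exact mul_pos (Real.sin_pos_of_pos_of_lt_pi (by positivity) (by nlinarith)) (Real.cosh_pos _)

/-- The image has vertex `ε > 0`, so it lies in the sector with vertex `0`, where the growth bounds
are available. -/
lemma stripToSector_mem {ε A : ℝ} (hε : 0 < ε) (hA : 0 < A) {s : ℂ} (h0 : 0 < s.re)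
    (h1 : s.re ≤ 1) : |(stripToSector ε A s).im| ≤ (stripToSector ε A s).re := by
  have h := cpow_neg_half_sector (sin_half_pi_mul_re_pos h0 h1)
  simp only [stripToSector, Complex.add_im, Complex.add_re, Complex.ofReal_im, Complex.ofReal_re,
    Complex.re_ofReal_mul, Complex.im_ofReal_mul, zero_add]
  rw [abs_mul, abs_of_pos hA]
  nlinarith

lemma stripToSector_differentiableAt {ε A : ℝ} {s : ℂ} (h0 : 0 < s.re) (h1 : s.re ≤ 1) :
    DifferentiableAt ℂ (stripToSector ε A) s := by
  have h := sin_half_pi_mul_re_pos h0 h1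
  unfold stripToSector
  refine (differentiableAt_const _).add ((differentiableAt_const _).mul ?_)
  refine DifferentiableAt.cpow (by fun_prop) (by fun_prop) (Or.inl h)

/-- On this line the sine equals `cosh (π Im s / 2) ≥ 1`, so its power `-1/2` lies in `(0, 1]`: this
side of the strip folds onto the slit. -/
lemma stripToSector_one_line {ε A : ℝ} (hA : 0 < A) {s : ℂ} (h : s.re = 1) :
    ∃ κ ∈ Set.Ioc ε (A + ε), stripToSector ε A s = (κ : ℂ) := by
  have hs : (Complex.sin (Real.pi / 2 * s)) = ((Real.cosh (Real.pi / 2 * s.im) : ℝ) : ℂ) := by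
    have : (Real.pi / 2 * s : ℂ) = ((Real.pi / 2 : ℝ) : ℂ)
        + ((Real.pi / 2 * s.im : ℝ) : ℂ) * Complex.I := by
      conv_lhs => rw [← Complex.re_add_im s, h]
      push_cast; ring
    rw [this, Complex.sin_add_mul_I, ← Complex.ofReal_sin, ← Complex.ofReal_cos, Real.sin_pi_div_two,
      Real.cos_pi_div_two]
    simp
  set c := Real.cosh (Real.pi / 2 * s.im)
  have hc : 1 ≤ c := Real.one_le_cosh _
  refine ⟨ε + A * c ^ (-(1 / 2) : ℝ), ⟨?_, ?_⟩, ?_⟩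
  · have : 0 < c ^ (-(1 / 2) : ℝ) := Real.rpow_pos_of_pos (by linarith) _
    nlinarith
  · have : c ^ (-(1 / 2) : ℝ) ≤ 1 := Real.rpow_le_one_of_one_le_of_nonpos hc (by norm_num)
    nlinarith
  · rw [stripToSector, hs]
    push_cast [Complex.ofReal_cpow (by linarith : 0 ≤ c)]
    rfl

/-- The exponent of the two-constants estimate in the slit sector. -/
noncomputable def sectorExponent (ε A κ : ℝ) : ℝ :=
  2 / Real.pi * Real.arcsin (((κ - ε) / A) ^ 2)⁻¹

section
variable {ε A κ : ℝ}

lemma one_lt_scaled (hA : 0 < A) (hκ : A + ε < κ) : 1 < (κ - ε) / A := by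
  rw [lt_div_iff₀ hA]; linarith

lemma sectorExponent_pos (hA : 0 < A) (hκ : A + ε < κ) : 0 < sectorExponent ε A κ := by
  have h := one_lt_scaled hA hκ
  have := Real.pi_pos
  exact mul_pos (by positivity) (Real.arcsin_pos.2 (by positivity))

lemma sectorExponent_le_one : sectorExponent ε A κ ≤ 1 := by
  have := Real.pi_pos
  have h := Real.arcsin_le_pi_div_two (((κ - ε) / A) ^ 2)⁻¹
  rw [sectorExponent, div_mul_eq_mul_div, div_le_one this]
  linarith

lemma stripToSector_sectorExponent (hA : 0 < A) (hκ : A + ε < κ) :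
    stripToSector ε A (sectorExponent ε A κ : ℝ) = (κ : ℂ) := by
  have h := one_lt_scaled hA hκ
  have hpi := Real.pi_pos
  set z := (κ - ε) / A with hz
  have h1 : (z ^ 2)⁻¹ ≤ 1 := inv_le_one_of_one_le₀ (by nlinarith)
  have h2 : (Real.pi / 2 * (sectorExponent ε A κ : ℝ) : ℂ) = (Real.arcsin (z ^ 2)⁻¹ : ℝ) := by
    rw [sectorExponent, ← hz]
    push_cast
    have : (Real.pi : ℂ) ≠ 0 := by exact_mod_cast hpi.ne'
    field_simp
  have hpos : 0 < (z ^ 2)⁻¹ := by positivity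
  rw [stripToSector, h2, ← Complex.ofReal_sin, Real.sin_arcsin (by linarith) h1]
  have h3 : ((z ^ 2)⁻¹ : ℝ) ^ (-(1 / 2) : ℝ) = z := by
    rw [Real.rpow_neg hpos.le, ← Real.inv_rpow hpos.le, inv_inv, ← Real.sqrt_eq_rpow,
      Real.sqrt_sq (by linarith)]
  have h4 : (((z ^ 2)⁻¹ : ℝ) : ℂ) ^ (-(1 / 2) : ℂ) = z := by
    conv_rhs => rw [← h3, Complex.ofReal_cpow hpos.le]
    push_cast; rfl
  rw [h4, hz]
  have : (A : ℂ) ≠ 0 := by exact_mod_cast hA.ne'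
  push_cast
  field_simp
  ring

lemma half_le_sectorExponent (hA : 0 < A)
    (hκ : κ ∈ Set.Ioo (A + ε) (ε + (2 : ℝ) ^ (1 / 4 : ℝ) * A)) :
    1 / 2 ≤ sectorExponent ε A κ := by
  have h := one_lt_scaled hA hκ.1
  have hpi := Real.pi_pos
  have h2 : (κ - ε) / A < (2 : ℝ) ^ (1 / 4 : ℝ) := by
    rw [div_lt_iff₀ hA]; linarith [hκ.2]
  set z := (κ - ε) / A with hz
  have h3 : z ^ 2 ≤ √2 := by
    have : ((2 : ℝ) ^ (1 / 4 : ℝ)) ^ 2 = √2 := by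
      rw [Real.sqrt_eq_rpow, ← Real.rpow_natCast, ← Real.rpow_mul (by norm_num)]; norm_num
    rw [← this]; gcongr
  -- The threshold `2^{1/4}` is where `z⁻² = 1/√2 = sin (π/4)`.
  have h4 : Real.pi / 4 ≤ Real.arcsin (z ^ 2)⁻¹ := by
    rw [Real.le_arcsin_iff_sin_le' (by constructor <;> linarith), Real.sin_pi_div_four]
    rw [le_inv_comm₀ (by positivity) (by positivity)]
    refine h3.trans (le_of_eq ?_)
    have : (0 : ℝ) < √2 := by positivity
    field_simp
    norm_num
  rw [sectorExponent, ← hz, div_mul_eq_mul_div, le_div_iff₀ hpi]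
  linarith

lemma rpow_le_sectorExponent (hA : 0 < A)
    (hκ : κ ∈ Set.Ioi (ε + (2 : ℝ) ^ (1 / 4 : ℝ) * A)) :
    1 / Real.pi * (((κ - ε) / A) ^ 4 - 1) ^ (-(1 / 2) : ℝ) ≤ sectorExponent ε A κ := by
  have hpi := Real.pi_pos
  have h2 : (2 : ℝ) ^ (1 / 4 : ℝ) < (κ - ε) / A := by
    rw [lt_div_iff₀ hA]; linarith [Set.mem_Ioi.1 hκ]
  rw [sectorExponent]
  set z := (κ - ε) / A with hz
  have h3 : 2 < z ^ 4 := by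
    have : ((2 : ℝ) ^ (1 / 4 : ℝ)) ^ 4 = 2 := by
      rw [← Real.rpow_natCast, ← Real.rpow_mul (by norm_num)]; norm_num
    rw [← this]
    gcongr
  have hz2 : 0 < z ^ 2 := by
    have : (0 : ℝ) < (2 : ℝ) ^ (1 / 4 : ℝ) := by positivity
    have : 0 < z := by linarith
    positivity
  have h1 : (z ^ 2)⁻¹ ≤ 1 := inv_le_one_of_one_le₀ (by nlinarith)
  have hpos : 0 < (z ^ 2)⁻¹ := by positivity
  have h5 : (z ^ 2)⁻¹ ≤ Real.arcsin (z ^ 2)⁻¹ := by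
    have h6 : 0 ≤ Real.arcsin (z ^ 2)⁻¹ := Real.arcsin_nonneg.2 hpos.le
    have := Real.sin_le h6
    rwa [Real.sin_arcsin (by linarith) h1] at this
  -- Equivalent to `z⁴/4 ≤ z⁴ - 1`, which holds because `z⁴ > 2`. Together with `x ≤ arcsin x` this
  -- gives the stated lower bound.
  have h7 : (z ^ 4 - 1) ^ (-(1 / 2) : ℝ) ≤ 2 * (z ^ 2)⁻¹ := by
    rw [Real.rpow_neg (by linarith), ← Real.sqrt_eq_rpow, ← inv_inv (2 : ℝ), ← mul_inv]
    refine inv_anti₀ (by positivity) ?_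
    refine Real.le_sqrt_of_sq_le ?_
    nlinarith
  calc 1 / Real.pi * (z ^ 4 - 1) ^ (-(1 / 2) : ℝ)
      ≤ 1 / Real.pi * (2 * (z ^ 2)⁻¹) := by gcongr
    _ = 2 / Real.pi * (z ^ 2)⁻¹ := by ring
    _ ≤ _ := by gcongr

end

/-- Two-constants estimate: a function bounded by `M` in a right-angled sector and by `m` on an
interval of its axis. -/
theorem norm_le_of_bound_on_slit {ε A κ M m : ℝ} {J : ℂ → ℂ} (hε : 0 < ε) (hA : 0 < A)
    (hκ : A + ε < κ) (hJ : Differentiable ℂ J)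
    (hM : ∀ k : ℂ, |k.im| ≤ k.re → ‖J k‖ ≤ M)
    (hm : ∀ t ∈ Set.Ioo ε (A + ε), ‖J (t : ℂ)‖ ≤ m) :
    ‖J κ‖ ≤ M ^ (1 - sectorExponent ε A κ) * m ^ sectorExponent ε A κ := by
  open Complex.HadamardThreeLines in
  set β := sectorExponent ε A κ with hβ
  have hβ0 : 0 < β := sectorExponent_pos hA hκ
  have hβ1 : β ≤ 1 := sectorExponent_le_one
  have hM0 : 0 ≤ M := (norm_nonneg _).trans (hM 0 (by simp))
  -- The tip `A + ε` is the image of `s = 1`, so the bound is extended to it by continuity.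
  have hm' : ∀ t ∈ Set.Ioc ε (A + ε), ‖J (t : ℂ)‖ ≤ m := by
    intro t ht
    have hc : Continuous fun t : ℝ => ‖J (t : ℂ)‖ :=
      (hJ.continuous.comp Complex.continuous_ofReal).norm
    refine le_on_closure (s := Set.Ioo ε (A + ε)) hm hc.continuousOn continuousOn_const ?_
    rw [closure_Ioo (by linarith)]
    exact Set.Ioc_subset_Icc_self ht
  -- The point `s = 0` is sent to infinity, so three lines is applied on `δ ≤ Re s ≤ 1`, followed by
  -- `δ → 0`.
  have key : ∀ δ ∈ Set.Ioo 0 β, ‖J κ‖ ≤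
      M ^ (1 - (β - δ) / (1 - δ)) * m ^ ((β - δ) / (1 - δ)) := by
    intro δ hδ
    have h := norm_le_interp_of_mem_verticalClosedStrip' (f := fun s => J (stripToSector ε A s))
      (z := (β : ℂ)) (a := M) (b := m) (l := δ) (u := 1) (by linarith [hδ.2])
      ⟨by simpa using hδ.2.le, by simpa using hβ1⟩ ?_ ?_ ?_ ?_
    · simpa [stripToSector_sectorExponent hA hκ, hβ] using h
    · apply DifferentiableOn.diffContOnCl
      intro s hs
      have hs' : s ∈ verticalClosedStrip δ 1 :=
        closure_minimal (Set.preimage_mono Set.Ioo_subset_Icc_self)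
          (isClosed_Icc.preimage Complex.continuous_re) hs
      exact ((hJ _).comp s (stripToSector_differentiableAt (by linarith [hδ.1, hs'.1])
        hs'.2)).differentiableWithinAt
    · refine ⟨M, ?_⟩
      rintro _ ⟨s, hs, rfl⟩
      exact hM _ (stripToSector_mem hε hA (by linarith [hδ.1, hs.1]) hs.2)
    · intro s hs
      have hs : s.re = δ := hs
      exact hM _ (stripToSector_mem hε hA (by linarith [hδ.1]) (by linarith [hδ.2]))
    · intro s hs
      obtain ⟨t, ht, hst⟩ := stripToSector_one_line (ε := ε) hA hs
      simp only [hst]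
      exact hm' t ht
  -- For `β = 1` the exponents do not depend on `δ`. This avoids a limit of `M ^ t` as `t → 0`,
  -- which is not continuous there when `M = 0`.
  rcases eq_or_ne β 1 with h1 | h1
  · rw [h1]
    have := key (1 / 2) ⟨by norm_num, by rw [h1]; norm_num⟩
    rw [h1] at this
    norm_num at this ⊢
    exact this
  have hlt : β < 1 := lt_of_le_of_ne hβ1 h1
  have hcont : Tendsto (fun δ : ℝ => M ^ (1 - (β - δ) / (1 - δ)) * m ^ ((β - δ) / (1 - δ)))
      (𝓝[>] 0) (𝓝 (M ^ (1 - β) * m ^ β)) := by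
    have h0 : Tendsto (fun δ : ℝ => (β - δ) / (1 - δ)) (𝓝[>] 0) (𝓝 β) := by
      have : ContinuousAt (fun δ : ℝ => (β - δ) / (1 - δ)) 0 := by
        refine ContinuousAt.div (by fun_prop) (by fun_prop) (by norm_num)
      simpa using this.tendsto.mono_left nhdsWithin_le_nhds
    refine Tendsto.mul ?_ ?_
    · exact (tendsto_const_nhds).rpow (tendsto_const_nhds.sub h0) (Or.inr (by linarith))
    · exact (tendsto_const_nhds).rpow h0 (Or.inr hβ0)
  refine ge_of_tendsto hcont ?_
  filter_upwards [Ioo_mem_nhdsGT hβ0] with δ hδ using key δ hδ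

/-- Differentiability of an integral depending on a complex parameter, from bounds alone. -/
theorem differentiable_integral_of_bound {α : Type*} [MeasurableSpace α] {μ : Measure α}
    {F : ℂ → α → ℂ} (hmeas : ∀ z, AEStronglyMeasurable (F z) μ)
    (hdiff : ∀ a, Differentiable ℂ fun z => F z a)
    (hbound : ∀ r : ℝ, ∃ b : α → ℝ, Integrable b μ ∧ ∀ z, ‖z‖ ≤ r → ∀ a, ‖F z a‖ ≤ b a) :
    Differentiable ℂ fun z => ∫ a, F z a ∂μ := by
  intro z₀
  obtain ⟨b, hb, hFb⟩ := hbound (‖z₀‖ + 2)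
  have hmeas' : AEStronglyMeasurable (fun a => deriv (fun z => F z a) z₀) μ := by
    have hlim : ∀ a, Tendsto (fun n : ℕ => ((n : ℂ) + 1) * (F (z₀ + 1 / ((n : ℂ) + 1)) a - F z₀ a))
        atTop (𝓝 (deriv (fun z => F z a) z₀)) := by
      intro a
      have h1 := (hdiff a z₀).hasDerivAt.tendsto_slope_zero
      have h2 : Tendsto (fun n : ℕ => (1 / ((n : ℂ) + 1))) atTop (𝓝[≠] 0) := by
        refine tendsto_nhdsWithin_iff.2 ⟨tendsto_one_div_add_atTop_nhds_zero_nat, ?_⟩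
        refine Eventually.of_forall fun n => ?_
        have : (n : ℂ) + 1 ≠ 0 := by exact_mod_cast n.succ_ne_zero
        simpa using this
      refine (h1.comp h2).congr fun n => ?_
      simp
    exact aestronglyMeasurable_of_tendsto_ae atTop
      (fun n => (((hmeas _).sub (hmeas _)).const_mul _)) (Eventually.of_forall hlim)
  refine (hasDerivAt_integral_of_dominated_loc_of_deriv_le (bound := b)
    (F' := fun z a => deriv (fun z => F z a) z) (Metric.ball_mem_nhds z₀ one_pos)
    (Eventually.of_forall hmeas) ?_ hmeas' ?_ hb ?_).2.differentiableAt
  · exact hb.mono' (hmeas z₀) (Eventually.of_forall fun a => hFb z₀ (by linarith) a)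
  · refine Eventually.of_forall fun a z hz => ?_
    -- Cauchy's estimate on the unit circle about `z` turns the bound on `F` into one on its
    -- derivative; hence the radius `‖z₀‖ + 2`.
    have := Complex.norm_deriv_le_of_forall_mem_sphere_norm_le (c := z) (R := 1) (C := b a)
      (f := fun z => F z a) one_pos (hdiff a).diffContOnCl ?_
    · simpa using this
    · intro w hw
      refine hFb w ?_ a
      have h1 : ‖w - z‖ = 1 := by simpa [dist_eq_norm] using hw
      have h2 : ‖z - z₀‖ < 1 := by simpa [dist_eq_norm] using hz
      calc ‖w‖ = ‖(w - z) + (z - z₀) + z₀‖ := by ring_nf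
        _ ≤ ‖w - z‖ + ‖z - z₀‖ + ‖z₀‖ := norm_add₃_le
        _ ≤ _ := by linarith
  · exact Eventually.of_forall fun a z _ => (hdiff a z).hasDerivAt

/-! ### Product rule, radial functions and Green's identity for the Laplacian. -/

section LaplacianCalculus

/-- The standard orthonormal basis of `E3`. -/
noncomputable abbrev stdBasis : OrthonormalBasis (Fin 3) ℝ E3 := EuclideanSpace.basisFun (Fin 3) ℝ

variable {F : Type*} [NormedAddCommGroup F] [NormedSpace ℝ F]

lemma laplacian_eq_sum_fderiv {f : E3 → F} {x : E3} (hf : ContDiffAt ℝ 2 f x) :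
    Δ f x = ∑ i, fderiv ℝ (fun y => fderiv ℝ f y (stdBasis i)) x (stdBasis i) := by
  rw [InnerProductSpace.laplacian_eq_iteratedFDeriv_orthonormalBasis f stdBasis]
  refine Finset.sum_congr rfl fun i _ => ?_
  have hd : DifferentiableAt ℝ (fderiv ℝ f) x :=
    (hf.fderiv_right (m := 1) (by norm_num)).differentiableAt (by norm_num)
  rw [iteratedFDeriv_two_apply, fderiv_clm_apply hd (differentiableAt_const _)]
  simp

lemma continuous_laplacian {f : E3 → F} (hf : ContDiff ℝ 2 f) : Continuous (Δ f) := by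
  have : Δ f = fun x => ∑ i, fderiv ℝ (fun y => fderiv ℝ f y (stdBasis i)) x (stdBasis i) :=
    funext fun x => laplacian_eq_sum_fderiv hf.contDiffAt
  rw [this]
  refine continuous_finsetSum _ fun i _ => ?_
  have h1 : ContDiff ℝ 1 (fun y => fderiv ℝ f y (stdBasis i)) :=
    (hf.fderiv_right (m := 1) (by norm_num)).clm_apply contDiff_const
  exact (h1.continuous_fderiv (by norm_num)).clm_apply continuous_const

lemma contDiff_fderiv_apply {f : E3 → F} {n : ℕ∞ω} (hf : ContDiff ℝ (n + 1) f) (v : E3) :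
    ContDiff ℝ n (fun y => fderiv ℝ f y v) :=
  (hf.fderiv_right le_rfl).clm_apply contDiff_const

lemma contDiff_laplacian {f : E3 → F} (hf : ContDiff ℝ ∞ f) : ContDiff ℝ ∞ (Δ f) := by
  have : Δ f = fun x => ∑ i, fderiv ℝ (fun y => fderiv ℝ f y (stdBasis i)) x (stdBasis i) :=
    funext fun x => laplacian_eq_sum_fderiv (hf.of_le (by norm_cast)).contDiffAt
  rw [this]
  refine ContDiff.sum fun i _ => ?_
  exact contDiff_fderiv_apply (n := ∞) (contDiff_fderiv_apply (n := ∞) hf _) _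

lemma HasCompactSupport.laplacian {f : E3 → F} (hf : HasCompactSupport f) :
    HasCompactSupport (Δ f) := by
  refine hf.mono' ?_
  intro x hx
  by_contra h
  have h0 : f =ᶠ[𝓝 x] fun _ => 0 := notMem_tsupport_iff_eventuallyEq.1 h
  have h1 := (InnerProductSpace.laplacian_congr_nhds h0).eq_of_nhds
  rw [InnerProductSpace.laplacian_const] at h1
  exact hx h1

lemma laplacian_mul {f g : E3 → ℂ} {x : E3} (hf : ContDiffAt ℝ 2 f x) (hg : ContDiffAt ℝ 2 g x) :
    Δ (fun y => f y * g y) x = f x * Δ g x + g x * Δ f x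
      + 2 * ∑ i, fderiv ℝ f x (stdBasis i) * fderiv ℝ g x (stdBasis i) := by
  rw [laplacian_eq_sum_fderiv (hf.mul hg), laplacian_eq_sum_fderiv hf, laplacian_eq_sum_fderiv hg,
    Finset.mul_sum, Finset.mul_sum, Finset.mul_sum, ← Finset.sum_add_distrib,
    ← Finset.sum_add_distrib]
  refine Finset.sum_congr rfl fun i _ => ?_
  have hfd : ∀ᶠ y in 𝓝 x, ContDiffAt ℝ 2 f y := hf.eventually (by simp)
  have hgd : ∀ᶠ y in 𝓝 x, ContDiffAt ℝ 2 g y := hg.eventually (by simp)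
  have h1 : (fun y => fderiv ℝ (fun y => f y * g y) y (stdBasis i)) =ᶠ[𝓝 x]
      fun y => f y * fderiv ℝ g y (stdBasis i) + g y * fderiv ℝ f y (stdBasis i) := by
    filter_upwards [hfd, hgd] with y hfy hgy
    rw [fderiv_fun_mul (hfy.differentiableAt (by norm_num)) (hgy.differentiableAt (by norm_num))]
    simp
  have dd : ∀ {h : E3 → ℂ}, ContDiffAt ℝ 2 h x →
      DifferentiableAt ℝ (fun y => fderiv ℝ h y (stdBasis i)) x := fun hh =>
    ((hh.fderiv_right (m := 1) (by norm_num)).differentiableAt (by norm_num)).clm_apply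
      (differentiableAt_const _)
  have df := hf.differentiableAt (by norm_num)
  have dg := hg.differentiableAt (by norm_num)
  rw [h1.fderiv_eq, fderiv_fun_add (df.fun_mul (dd hg)) (dg.fun_mul (dd hf)), fderiv_fun_mul df (dd hg),
    fderiv_fun_mul dg (dd hf)]
  simp
  ring

lemma hasFDerivAt_norm_sub {c x : E3} (hx : x ≠ c) :
    HasFDerivAt (fun y : E3 => ‖y - c‖) (‖x - c‖⁻¹ • innerSL ℝ (x - c)) x := by
  have h0 : 0 < ‖x - c‖ := norm_pos_iff.2 (sub_ne_zero.2 hx)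
  have h1 : HasFDerivAt (fun y : E3 => ‖y - c‖ ^ 2) (2 • innerSL ℝ (x - c)) x := by
    simpa using ((hasFDerivAt_id x).sub_const c).norm_sq
  have h2 := h1.sqrt (by positivity)
  simp only [Real.sqrt_sq (norm_nonneg _)] at h2
  convert! h2 using 1
  ext v
  simp
  field_simp

lemma hasFDerivAt_radial {B : ℝ → F} {B' : F} {c x : E3} (hx : x ≠ c)
    (hB : HasDerivAt B B' ‖x - c‖) :
    HasFDerivAt (fun y : E3 => B ‖y - c‖)
      ((‖x - c‖⁻¹ • innerSL ℝ (x - c)).smulRight B') x := by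
  convert! HasFDerivAt.comp (g := B) x hB.hasFDerivAt (hasFDerivAt_norm_sub hx)

lemma contDiffAt_radial {B : ℝ → F} {c x : E3} {n : ℕ∞ω} (hx : x ≠ c)
    (hB : ContDiffAt ℝ n B ‖x - c‖) : ContDiffAt ℝ n (fun y : E3 => B ‖y - c‖) x := by
  have : ContDiffAt ℝ n (fun y : E3 => ‖y - c‖) x :=
    (contDiffAt_id.sub contDiffAt_const).norm ℝ (sub_ne_zero.2 hx)
  exact hB.comp x this

lemma laplacian_radial {B : ℝ → ℂ} {c x : E3} (hx : x ≠ c)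
    (hB : ContDiffAt ℝ 2 B ‖x - c‖) :
    Δ (fun y : E3 => B ‖y - c‖) x =
      deriv (deriv B) ‖x - c‖ + 2 / (‖x - c‖ : ℂ) * deriv B ‖x - c‖ := by
  rw [laplacian_eq_sum_fderiv (contDiffAt_radial hx hB)]
  set N := ‖x - c‖ with hN
  have hN0 : 0 < N := norm_pos_iff.2 (sub_ne_zero.2 hx)
  have hcont : Tendsto (fun y : E3 => ‖y - c‖) (𝓝 x) (𝓝 N) := by
    have : Continuous fun y : E3 => ‖y - c‖ := by fun_prop
    exact this.tendsto x
  have hne : ∀ᶠ y in 𝓝 x, y ≠ c := eventually_ne_nhds hx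
  have hBn : ∀ᶠ y in 𝓝 x, ContDiffAt ℝ 2 B ‖y - c‖ := hcont.eventually (hB.eventually (by simp))
  have hB' : HasDerivAt (deriv B) (deriv (deriv B) N) N := by
    have h := (hB.fderiv_right (m := 1) (by norm_num)).differentiableAt (by norm_num)
    have : DifferentiableAt ℝ (fun t => fderiv ℝ B t 1) N := h.clm_apply (differentiableAt_const _)
    exact DifferentiableAt.hasDerivAt (by simpa using this)
  -- Diagonal Hessian entry of a radial function: `B''` along the radial direction and `B'/N` across
  -- it.
  have hterm : ∀ i, fderiv ℝ (fun y => fderiv ℝ (fun y : E3 => B ‖y - c‖) y (stdBasis i)) x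
      (stdBasis i) = (((x - c) i) ^ 2 / N ^ 2 : ℝ) • deriv (deriv B) N
        + (1 / N - ((x - c) i) ^ 2 / N ^ 3 : ℝ) • deriv B N := by
    intro i
    have h1 : (fun y => fderiv ℝ (fun y : E3 => B ‖y - c‖) y (stdBasis i)) =ᶠ[𝓝 x]
        fun y => (‖y - c‖⁻¹ * (y - c) i) • deriv B ‖y - c‖ := by
      filter_upwards [hne, hBn] with y hy hBy
      rw [(hasFDerivAt_radial hy (hBy.differentiableAt (by norm_num)).hasDerivAt).fderiv]
      simp [EuclideanSpace.inner_single_right]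
    have h2 : HasFDerivAt (fun y : E3 => ‖y - c‖⁻¹) _ x :=
      (hasDerivAt_inv hN0.ne').comp_hasFDerivAt x (hasFDerivAt_norm_sub hx)
    have h3 : HasFDerivAt (fun y : E3 => (y - c) i) (EuclideanSpace.proj i : E3 →L[ℝ] ℝ) x := by
      have := (EuclideanSpace.proj i : E3 →L[ℝ] ℝ).hasFDerivAt (x := x - c)
      exact this.comp x ((hasFDerivAt_id x).sub_const c)
    have h4 : HasFDerivAt (fun y => (‖y - c‖⁻¹ * (y - c) i) • deriv B ‖y - c‖) _ x :=
      (h2.mul h3).smul (hasFDerivAt_radial hx hB')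
    rw [h1.fderiv_eq, h4.fderiv]
    simp [← hN, EuclideanSpace.inner_single_right]
    field_simp
    ring
  simp only [hterm]
  rw [Finset.sum_add_distrib, ← Finset.sum_smul, ← Finset.sum_smul, ← Finset.sum_div,
    Finset.sum_sub_distrib, ← Finset.sum_div (f := fun i => (x - c) i ^ 2)]
  have hs : ∑ i, ((x - c) i) ^ 2 = N ^ 2 := by
    rw [hN, EuclideanSpace.norm_sq_eq]
    simp
  rw [hs]
  have e1 : N ^ 2 / N ^ 2 = 1 := by field_simp
  have e2 : (∑ i : Fin 3, 1 / N) - N ^ 2 / N ^ 3 = 2 / N := by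
    simp; field_simp; norm_num
  rw [e1, e2]
  simp [Complex.real_smul]

lemma integral_mul_laplacian {u φ : E3 → ℂ} (hu : ContDiff ℝ 2 u) (hφ : ContDiff ℝ 2 φ)
    (hc : HasCompactSupport φ) : ∫ x, u x * Δ φ x = ∫ x, Δ u x * φ x := by
  have hu1 : ∀ i, ContDiff ℝ 1 (fun y => fderiv ℝ u y (stdBasis i)) := fun i =>
    contDiff_fderiv_apply (n := 1) hu _
  have hφ1 : ∀ i, ContDiff ℝ 1 (fun y => fderiv ℝ φ y (stdBasis i)) := fun i =>
    contDiff_fderiv_apply (n := 1) hφ _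
  have hc1 : ∀ i, HasCompactSupport (fun y => fderiv ℝ φ y (stdBasis i)) := fun i =>
    hc.fderiv_apply ℝ _
  have hu2 : ∀ i, Continuous (fun y => fderiv ℝ (fun y => fderiv ℝ u y (stdBasis i)) y
      (stdBasis i)) := fun i => (contDiff_fderiv_apply (n := 0) (hu1 i) _).continuous
  have hφ2 : ∀ i, Continuous (fun y => fderiv ℝ (fun y => fderiv ℝ φ y (stdBasis i)) y
      (stdBasis i)) := fun i => (contDiff_fderiv_apply (n := 0) (hφ1 i) _).continuous
  have hc2 : ∀ i, HasCompactSupport (fun y => fderiv ℝ (fun y => fderiv ℝ φ y (stdBasis i)) y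
      (stdBasis i)) := fun i => (hc1 i).fderiv_apply ℝ _
  have int1 : ∀ {a b : E3 → ℂ}, Continuous a → Continuous b → HasCompactSupport b →
      Integrable (fun x => a x * b x) := fun ha hb hbc =>
    (ha.mul hb).integrable_of_hasCompactSupport hbc.mul_left
  have key : ∀ i, ∫ x, u x * fderiv ℝ (fun y => fderiv ℝ φ y (stdBasis i)) x (stdBasis i)
      = ∫ x, fderiv ℝ (fun y => fderiv ℝ u y (stdBasis i)) x (stdBasis i) * φ x := by
    intro i
    rw [integral_mul_fderiv_eq_neg_fderiv_mul_of_integrable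
      (int1 (hu1 i).continuous (hφ1 i).continuous (hc1 i)) (int1 hu.continuous (hφ2 i) (hc2 i))
      (int1 hu.continuous (hφ1 i).continuous (hc1 i))
      (fun x _ => (hu.differentiable (by norm_num)) x)
      (fun x _ => ((hφ1 i).differentiable (by norm_num)) x),
      integral_mul_fderiv_eq_neg_fderiv_mul_of_integrable
      (int1 (hu2 i) hφ.continuous hc) (int1 (hu1 i).continuous (hφ1 i).continuous (hc1 i))
      (int1 (hu1 i).continuous hφ.continuous hc)
      (fun x _ => ((hu1 i).differentiable (by norm_num)) x)
      (fun x _ => (hφ.differentiable (by norm_num)) x), neg_neg]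
  have e1 : (fun x => u x * Δ φ x) = fun x =>
      ∑ i, u x * fderiv ℝ (fun y => fderiv ℝ φ y (stdBasis i)) x (stdBasis i) := by
    ext x; rw [laplacian_eq_sum_fderiv hφ.contDiffAt, Finset.mul_sum]
  have e2 : (fun x => Δ u x * φ x) = fun x =>
      ∑ i, fderiv ℝ (fun y => fderiv ℝ u y (stdBasis i)) x (stdBasis i) * φ x := by
    ext x; rw [laplacian_eq_sum_fderiv hu.contDiffAt, Finset.sum_mul]
  rw [e1, e2, integral_finsetSum _ fun i _ => int1 hu.continuous (hφ2 i) (hc2 i),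
    integral_finsetSum _ fun i _ => int1 (hu2 i) hφ.continuous hc]
  exact Finset.sum_congr rfl fun i _ => key i

end LaplacianCalculus

/-! ### Potentials of the source: bounds and analyticity in the parameter. -/

/-- The radial profile `e^{lr} / (4πr)` of the fundamental solution of `l² - Δ`. -/
noncomputable def yukawa (l : ℂ) (r : ℝ) : ℂ := Complex.exp (l * r) / (4 * Real.pi * r)

/-- The potential of the source `f` with kernel `yukawa l`. -/
noncomputable def pot (f : E3 → ℝ) (x : E3) (l : ℂ) : ℂ := ∫ y, yukawa l ‖y - x‖ * f y

lemma norm_yukawa (l : ℂ) {r : ℝ} (hr : 0 ≤ r) :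
    ‖yukawa l r‖ = Real.exp (l.re * r) / (4 * Real.pi * r) := by
  rw [yukawa, norm_div, Complex.norm_exp]
  have : ‖(4 * Real.pi * r : ℂ)‖ = 4 * Real.pi * r := by
    have h : (4 * Real.pi * r : ℂ) = ((4 * Real.pi * r : ℝ) : ℂ) := by push_cast; rfl
    rw [h, Complex.norm_real, Real.norm_of_nonneg (by have := Real.pi_pos; positivity)]
  rw [this]
  simp

/-- Schwarz reflection, valid because `f` is real. It allows complex conjugates in the boundary data
to be replaced by analytic functions. -/
lemma conj_pot (f : E3 → ℝ) (x : E3) (l : ℂ) :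
    (starRingEnd ℂ) (pot f x l) = pot f x ((starRingEnd ℂ) l) := by
  rw [pot, pot, ← integral_conj]
  congr 1
  ext y
  simp [yukawa, ← Complex.exp_conj, map_ofNat]

/-- The surface area of the unit sphere of `E3`. -/
noncomputable def sphereArea : ℝ := (volume : Measure E3).toSphere.real Set.univ

lemma integrable_inv_sq (x : E3) (ρ : ℝ) :
    Integrable (fun y : E3 => Set.indicator (Set.Iic ρ) (fun r : ℝ => (r ^ 2)⁻¹) ‖y - x‖) := by
  have h : Integrable (fun y : E3 => Set.indicator (Set.Iic ρ) (fun r : ℝ => (r ^ 2)⁻¹) ‖y‖) := by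
    rw [integrable_fun_norm_addHaar (μ := (volume : Measure E3))
      (f := Set.indicator (Set.Iic ρ) (fun r : ℝ => (r ^ 2)⁻¹))]
    have h1 : IntegrableOn (Set.indicator (Set.Iic ρ) (fun _ : ℝ => (1 : ℝ))) (Set.Ioi 0) := by
      rw [IntegrableOn, integrable_indicator_iff measurableSet_Iic, IntegrableOn,
        Measure.restrict_restrict measurableSet_Iic, Set.inter_comm, Set.Ioi_inter_Iic]
      exact integrableOn_const (by simp)
    refine h1.congr_fun (fun r hr => ?_) measurableSet_Ioi
    have hr : 0 < r := hr
    by_cases hρ : r ≤ ρ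
    · simp [hρ, hr.ne']
    · simp [hρ]
  exact h.comp_sub_right x

lemma integral_inv_sq (x : E3) {ρ : ℝ} (hρ : 0 ≤ ρ) :
    ∫ y : E3, Set.indicator (Set.Iic ρ) (fun r : ℝ => (r ^ 2)⁻¹) ‖y - x‖ = sphereArea * ρ := by
  rw [integral_sub_right_eq_self (fun y : E3 =>
      Set.indicator (Set.Iic ρ) (fun r : ℝ => (r ^ 2)⁻¹) ‖y‖) x,
    integral_fun_norm_addHaar (volume : Measure E3)
      (Set.indicator (Set.Iic ρ) (fun r : ℝ => (r ^ 2)⁻¹))]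
  have h1 : ∫ r in Set.Ioi (0 : ℝ), r ^ (Module.finrank ℝ E3 - 1) •
      Set.indicator (Set.Iic ρ) (fun r : ℝ => (r ^ 2)⁻¹) r
      = ∫ r in Set.Ioi (0 : ℝ), Set.indicator (Set.Iic ρ) (fun _ : ℝ => (1 : ℝ)) r := by
    refine setIntegral_congr_fun measurableSet_Ioi fun r hr => ?_
    have hr : 0 < r := hr
    by_cases hρ : r ≤ ρ
    · simp [hρ, hr.ne']
    · simp [hρ]
  rw [h1, setIntegral_indicator measurableSet_Iic, Set.Ioi_inter_Iic, sphereArea,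
    Measure.toSphere_real_apply_univ]
  simp [hρ]
  ring

section
variable {f : E3 → ℝ} {R S Q : ℝ}

/-- The inequality `2ab ≤ a² + b²`, weighted by `Q` so that both terms integrate to something linear
in `Q`. The kernel `1/r²` is integrable near `0` since the Jacobian in dimension three is `r²`. -/
lemma abs_div_le_of_support (hf : Function.support f ⊆ Metric.closedBall 0 R) {x : E3}
    (hx : ‖x‖ ≤ S) (hQ : 0 < Q) (y : E3) :
    |f y| / ‖y - x‖ ≤ 2⁻¹ * (Q * Set.indicator (Set.Iic (R + S)) (fun r : ℝ => (r ^ 2)⁻¹) ‖y - x‖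
      + Q⁻¹ * f y ^ 2) := by
  by_cases h0 : f y = 0
  · simp only [h0, abs_zero, zero_div]
    have : 0 ≤ Set.indicator (Set.Iic (R + S)) (fun r : ℝ => (r ^ 2)⁻¹) ‖y - x‖ :=
      Set.indicator_nonneg (fun r _ => by positivity) _
    positivity
  · have hy : ‖y‖ ≤ R := by simpa using hf h0
    have hN : ‖y - x‖ ≤ R + S := (norm_sub_le _ _).trans (by linarith)
    rw [Set.indicator_of_mem (by exact hN)]
    have hab := two_mul_le_add_sq (Q * ‖y - x‖⁻¹) |f y|
    rw [sq_abs] at hab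
    rw [div_eq_mul_inv, ← inv_pow]
    have h2 : Q⁻¹ * (2 * (Q * ‖y - x‖⁻¹) * |f y|) ≤ Q⁻¹ * ((Q * ‖y - x‖⁻¹) ^ 2 + f y ^ 2) := by
      gcongr
    have e1 : Q⁻¹ * (2 * (Q * ‖y - x‖⁻¹) * |f y|) = 2 * (|f y| * ‖y - x‖⁻¹) := by field_simp
    have e2 : Q⁻¹ * ((Q * ‖y - x‖⁻¹) ^ 2 + f y ^ 2)
        = Q * ‖y - x‖⁻¹ ^ 2 + Q⁻¹ * f y ^ 2 := by
      have : Q⁻¹ * Q = 1 := inv_mul_cancel₀ hQ.ne'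
      linear_combination Q * ‖y - x‖⁻¹ ^ 2 * this
    rw [e1, e2] at h2
    linarith

lemma integrable_abs_div (hf2 : MemLp f 2 volume)
    (hf : Function.support f ⊆ Metric.closedBall 0 R) (x : E3) :
    Integrable fun y => |f y| / ‖y - x‖ := by
  have hb := (((integrable_inv_sq x (R + ‖x‖)).const_mul 1).add
    (hf2.integrable_sq.const_mul (1 : ℝ)⁻¹)).const_mul 2⁻¹
  refine hb.mono' ?_ (Eventually.of_forall fun y => ?_)
  · have h1 := hf2.aestronglyMeasurable.aemeasurable
    have h2 : Measurable fun y : E3 => ‖y - x‖ := by fun_prop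
    exact (h1.abs.div h2.aemeasurable).aestronglyMeasurable
  · rw [Real.norm_of_nonneg (by positivity)]
    exact abs_div_le_of_support hf le_rfl one_pos y

lemma integral_abs_div_le (hf2 : MemLp f 2 volume)
    (hf : Function.support f ⊆ Metric.closedBall 0 R) {x : E3} (hR : 0 ≤ R) (hx : ‖x‖ ≤ S)
    (hQ : 0 < Q) (hfQ : ∫ y, f y ^ 2 ≤ Q ^ 2) :
    ∫ y, |f y| / ‖y - x‖ ≤ 2⁻¹ * (sphereArea * (R + S) + 1) * Q := by
  have hS : 0 ≤ S := (norm_nonneg x).trans hx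
  have i1 := (integrable_inv_sq x (R + S)).const_mul Q
  have i2 := hf2.integrable_sq.const_mul Q⁻¹
  refine (integral_mono (integrable_abs_div hf2 hf x) ((i1.add i2).const_mul 2⁻¹)
    (abs_div_le_of_support hf hx hQ)).trans ?_
  simp only [Pi.add_apply]
  rw [integral_const_mul, integral_add i1 i2, integral_const_mul, integral_const_mul,
    integral_inv_sq x (by positivity)]
  have : Q⁻¹ * ∫ y, f y ^ 2 ≤ Q := by
    rw [inv_mul_le_iff₀ hQ]; nlinarith
  linarith

lemma norm_yukawa_mul_le (hf : Function.support f ⊆ Metric.closedBall 0 R) {x : E3}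
    (hx : ‖x‖ ≤ S) {l : ℂ} {a : ℝ} (ha : 0 ≤ a) (hl : l.re ≤ a) (y : E3) :
    ‖yukawa l ‖y - x‖ * f y‖ ≤ Real.exp (a * (R + S)) * (|f y| / ‖y - x‖) := by
  by_cases h0 : f y = 0
  · simp [h0]
  have hy : ‖y‖ ≤ R := by simpa using hf h0
  have hN : ‖y - x‖ ≤ R + S := (norm_sub_le _ _).trans (by linarith)
  rw [norm_mul, norm_yukawa l (norm_nonneg _), Complex.norm_real, Real.norm_eq_abs]
  have h1 : Real.exp (l.re * ‖y - x‖) ≤ Real.exp (a * (R + S)) := by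
    refine Real.exp_le_exp.2 ?_
    nlinarith [norm_nonneg (y - x)]
  have hpi : 1 ≤ 4 * Real.pi := by linarith [Real.pi_gt_three]
  calc Real.exp (l.re * ‖y - x‖) / (4 * Real.pi * ‖y - x‖) * |f y|
      = (4 * Real.pi)⁻¹ * (Real.exp (l.re * ‖y - x‖) * (|f y| / ‖y - x‖)) := by
        rw [div_mul_eq_mul_div, mul_comm (4 * Real.pi), ← div_div, div_eq_mul_inv _ (4 * Real.pi)]
        ring
    _ ≤ 1 * (Real.exp (a * (R + S)) * (|f y| / ‖y - x‖)) := by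
        gcongr
        exact inv_le_one_of_one_le₀ hpi
    _ = _ := one_mul _

lemma measurable_yukawa (l : ℂ) : Measurable (yukawa l) := by
  unfold yukawa; fun_prop

lemma aestronglyMeasurable_yukawa_mul (hf2 : MemLp f 2 volume) (x : E3) (l : ℂ) :
    AEStronglyMeasurable (fun y => yukawa l ‖y - x‖ * f y) := by
  have h1 : AEMeasurable fun y => ((f y : ℝ) : ℂ) :=
    Complex.measurable_ofReal.comp_aemeasurable hf2.aestronglyMeasurable.aemeasurable
  have h2 : Measurable fun y : E3 => yukawa l ‖y - x‖ :=
    (measurable_yukawa l).comp (by fun_prop)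
  exact (h2.aemeasurable.mul h1).aestronglyMeasurable

lemma integrable_yukawa_mul (hf2 : MemLp f 2 volume)
    (hf : Function.support f ⊆ Metric.closedBall 0 R) (x : E3) (l : ℂ) :
    Integrable (fun y => yukawa l ‖y - x‖ * f y) :=
  ((integrable_abs_div hf2 hf x).const_mul (Real.exp (max l.re 0 * (R + ‖x‖)))).mono'
    (aestronglyMeasurable_yukawa_mul hf2 x l)
    (Eventually.of_forall fun y => norm_yukawa_mul_le hf le_rfl (le_max_right _ _)
      (le_max_left _ _) y)

lemma norm_pot_le (hf2 : MemLp f 2 volume)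
    (hf : Function.support f ⊆ Metric.closedBall 0 R) (hR : 0 ≤ R) {x : E3} (hx : ‖x‖ ≤ S)
    (hQ : 0 < Q) (hfQ : ∫ y, f y ^ 2 ≤ Q ^ 2) {l : ℂ} {a : ℝ} (ha : 0 ≤ a) (hl : l.re ≤ a) :
    ‖pot f x l‖ ≤ 2⁻¹ * (sphereArea * (R + S) + 1) * Q * Real.exp (a * (R + S)) := by
  refine (norm_integral_le_of_norm_le ((integrable_abs_div hf2 hf x).const_mul _)
    (Eventually.of_forall (norm_yukawa_mul_le hf hx ha hl))).trans ?_
  rw [integral_const_mul, mul_comm]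
  gcongr
  exact integral_abs_div_le hf2 hf hR hx hQ hfQ

lemma differentiable_pot (hf2 : MemLp f 2 volume)
    (hf : Function.support f ⊆ Metric.closedBall 0 R) (x : E3) :
    Differentiable ℂ (pot f x) := by
  refine differentiable_integral_of_bound (aestronglyMeasurable_yukawa_mul hf2 x) (fun y => ?_)
    (fun r => ⟨_, (integrable_abs_div hf2 hf x).const_mul (Real.exp (max r 0 * (R + ‖x‖))),
      fun z hz y => ?_⟩)
  · unfold yukawa; fun_prop
  · exact norm_yukawa_mul_le hf le_rfl (le_max_right _ _)
      ((Complex.re_le_norm z).trans (hz.trans (le_max_left _ _))) y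

lemma stronglyMeasurable_pot (hf2 : MemLp f 2 volume) (l : ℂ) :
    StronglyMeasurable fun x => pot f x l := by
  -- Joint measurability in `(x, y)` requires a genuinely measurable representative of `f`.
  obtain ⟨g, hg, hfg⟩ := hf2.aestronglyMeasurable
  have : (fun x => pot f x l) = fun x => ∫ y, yukawa l ‖y - x‖ * g y := by
    ext x
    refine integral_congr_ae ?_
    filter_upwards [hfg] with y hy
    rw [hy]
  rw [this]
  refine StronglyMeasurable.integral_prod_right (f := fun x y => yukawa l ‖y - x‖ * g y) ?_
  refine Measurable.stronglyMeasurable ?_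
  have h1 : Measurable fun p : E3 × E3 => yukawa l ‖p.2 - p.1‖ :=
    (measurable_yukawa l).comp (by fun_prop)
  have h2 : Measurable fun p : E3 × E3 => ((g p.2 : ℝ) : ℂ) :=
    Complex.measurable_ofReal.comp (hg.measurable.comp measurable_snd)
  exact h1.mul h2

end

/-! ### Integration by parts along a ray. -/

section RadialTail

/-- Along a ray, a function with outgoing phase `κ` tested against a kernel with phase `l`
over the transition region of a cutoff. -/
theorem norm_radial_tail_le {κ ρ r₀ c η K : ℝ} {l : ℂ} {W W' Φ Φ' s s' : ℝ → ℂ}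
    (hl : l + Complex.I * κ ≠ 0) (hρ : 1 ≤ ρ) (hr₀ : r₀ < ρ) (hK : 0 ≤ K) (hc : 0 ≤ c)
    (hη : 0 ≤ η)
    (hW : ∀ r ∈ Set.Ioi r₀, HasDerivAt W (W' r) r)
    (hΦ : ∀ r ∈ Set.Ioi r₀, HasDerivAt Φ (Φ' r) r)
    (hs : ∀ r ∈ Set.Ioi r₀, HasDerivAt s (s' r) r)
    (hΦ' : ContinuousOn Φ' (Set.Ioi r₀)) (hs' : ContinuousOn s' (Set.Ioi r₀))
    (hW1 : ∀ r ∈ Set.Icc ρ (2 * ρ), ‖W' r - Complex.I * κ * W r‖ ≤ η / r)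
    (hW0 : ∀ r ∈ Set.Icc ρ (2 * ρ), ‖W r‖ ≤ η * r)
    (hΦ0 : ∀ r ∈ Set.Icc ρ (2 * ρ), ‖Φ r‖ ≤ c / r)
    (hΦ1 : ∀ r ∈ Set.Icc ρ (2 * ρ), ‖Φ' r - l * Φ r + Φ r / r‖ ≤ c / r ^ 3)
    (hΦ2 : ∀ r ∈ Set.Icc ρ (2 * ρ), ‖(l - Complex.I * κ) * Φ r‖ ≤ c / r ^ 3)
    (hs0 : ∀ r ∈ Set.Icc ρ (2 * ρ), ‖s r‖ ≤ K / ρ)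
    (hs1 : ∀ r ∈ Set.Icc ρ (2 * ρ), ‖s' r‖ ≤ K / ρ ^ 2)
    (hsa : s ρ = 0) (hsb : s (2 * ρ) = 0) :
    ‖∫ r in ρ..2 * ρ, (r : ℂ) ^ 2 * (W r * ((s' r + 2 / r * s r) * Φ r + 2 * (s r * Φ' r)))‖ ≤
      (3 + 4 / ‖l + Complex.I * κ‖) * (K * c * η) := by
  set μ := l + Complex.I * κ with hμ
  set I : ℝ → ℂ := fun r =>
    (r : ℂ) ^ 2 * (W r * ((s' r + 2 / r * s r) * Φ r + 2 * (s r * Φ' r))) with hI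
  have hρ0 : 0 < ρ := by linarith
  set X := K * c * η / ρ with hX
  have hX0 : 0 ≤ X := by positivity
  -- the part of the domain that matters stays away from `0`
  set U : Set ℝ := Set.Ioi (max r₀ 0) with hU
  have hUo : IsOpen U := isOpen_Ioi
  have hU1 : ∀ r ∈ U, r ∈ Set.Ioi r₀ := fun r hr => lt_of_le_of_lt (le_max_left r₀ 0) hr
  have hU0 : ∀ r ∈ U, 0 < r := fun r hr => lt_of_le_of_lt (le_max_right _ _) hr
  have hIU : Set.Icc ρ (2 * ρ) ⊆ U := fun r hr =>
    Set.mem_Ioi.2 (max_lt (hr₀.trans_le hr.1) (hρ0.trans_le hr.1))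
  have cW : ContinuousOn W U := fun r hr => (hW r (hU1 r hr)).continuousAt.continuousWithinAt
  have cΦ : ContinuousOn Φ U := fun r hr => (hΦ r (hU1 r hr)).continuousAt.continuousWithinAt
  have cs : ContinuousOn s U := fun r hr => (hs r (hU1 r hr)).continuousAt.continuousWithinAt
  have cof : Continuous fun r : ℝ => (r : ℂ) := Complex.continuous_ofReal
  have cI : ContinuousOn I U := by
    have c2 : ContinuousOn (fun r : ℝ => (2 / r : ℂ)) U :=
      continuousOn_const.div cof.continuousOn fun r hr => by exact_mod_cast (hU0 r hr).ne'
    exact (cof.pow 2).continuousOn.mul (cW.mul ((((hs'.mono hU1).add (c2.mul cs)).mul cΦ).add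
      (continuousOn_const.mul (cs.mul (hΦ'.mono hU1)))))
  -- Subtracting `G1'` from the integrand leaves `r² s (Φ' W - Φ W')`, which is `-r s Φ W` up to
  -- errors controlled by the hypotheses. That term is still too large to integrate over a length
  -- `ρ`.
  set G1 : ℝ → ℂ := fun r => (r : ℂ) ^ 2 * (s r * (Φ r * W r)) with hG1
  set G2 : ℝ → ℂ := fun r => (r : ℂ) * (s r * (Φ r * W r)) with hG2
  -- As `Φ W` has phase `μ`, the remaining `r s Φ W` equals `μ⁻¹ G2'` up to `μ⁻¹ r s' Φ W` and small
  -- errors. The extra factor `1/ρ` in `s'` compensates for the length of the interval, and `G1`,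
  -- `G2` vanish at both ends with `s`.
  set H : ℝ → ℂ := fun r => (∫ t in ρ..r, I t) - G1 r + μ⁻¹ * G2 r with hH
  set H' : ℝ → ℂ := fun r =>
    (r : ℂ) ^ 2 * s r * (((l - Complex.I * κ) * Φ r) * W r
      + (Φ' r - l * Φ r + Φ r / r) * W r - Φ r * (W' r - Complex.I * κ * W r))
    + μ⁻¹ * ((r : ℂ) * s' r * (Φ r * W r) + (r : ℂ) * s r * ((Φ' r - l * Φ r + Φ r / r) * W r)
      + (r : ℂ) * s r * (Φ r * (W' r - Complex.I * κ * W r))) with hH'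
  have hder : ∀ r ∈ Set.Icc ρ (2 * ρ), HasDerivAt H (H' r) r := by
    intro r hr
    have hrU := hIU hr
    have hr1 := hU1 r hrU
    have hr0 : (r : ℂ) ≠ 0 := by exact_mod_cast (hU0 r hrU).ne'
    have hof : HasDerivAt (fun r : ℝ => (r : ℂ)) 1 r := Complex.ofRealCLM.hasDerivAt
    have hof2 : HasDerivAt (fun r : ℝ => (r : ℂ) ^ 2) (2 * r) r := by
      simpa using hof.fun_pow 2
    have hsub : Set.uIcc ρ r ⊆ U := by
      rw [Set.uIcc_of_le hr.1]
      exact (Set.Icc_subset_Icc_right hr.2).trans hIU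
    have dP : HasDerivAt (fun r => ∫ t in ρ..r, I t) (I r) r :=
      intervalIntegral.integral_hasDerivAt_right (cI.mono hsub).intervalIntegrable
        (cI.stronglyMeasurableAtFilter hUo r hrU) (cI.continuousAt (hUo.mem_nhds hrU))
    have dprod := (hs r hr1).mul ((hΦ r hr1).mul (hW r hr1))
    have := (dP.sub (hof2.mul dprod)).add ((hof.mul dprod).const_mul μ⁻¹)
    refine this.congr_deriv ?_
    simp only [hI, hH', Pi.mul_apply]
    have hμ' : l = μ - Complex.I * κ := by rw [hμ]; ring
    rw [hμ']
    field_simp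
    ring
  have hbd : ∀ r ∈ Set.Icc ρ (2 * ρ), ‖H' r‖ ≤ (3 + 4 / ‖μ‖) * X := by
    intro r hr
    have hr0 : 0 < r := hU0 r (hIU hr)
    have hr1 : 1 ≤ r := hρ.trans hr.1
    have hnr : ‖(r : ℂ)‖ = r := by rw [Complex.norm_real, Real.norm_of_nonneg hr0.le]
    have b1 : ‖(r : ℂ) ^ 2 * s r * (((l - Complex.I * κ) * Φ r) * W r)‖ ≤ X := by
      rw [norm_mul, norm_mul, norm_mul _ (W r), norm_pow, hnr]
      calc _ ≤ r ^ 2 * (K / ρ) * (c / r ^ 3 * (η * r)) := by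
            gcongr; exacts [hs0 r hr, hΦ2 r hr, hW0 r hr]
        _ = X := by rw [hX]; field_simp
    have b2 : ‖(r : ℂ) ^ 2 * s r * ((Φ' r - l * Φ r + Φ r / r) * W r)‖ ≤ X := by
      rw [norm_mul, norm_mul, norm_mul _ (W r), norm_pow, hnr]
      calc _ ≤ r ^ 2 * (K / ρ) * (c / r ^ 3 * (η * r)) := by
            gcongr; exacts [hs0 r hr, hΦ1 r hr, hW0 r hr]
        _ = X := by rw [hX]; field_simp
    have b3 : ‖(r : ℂ) ^ 2 * s r * (Φ r * (W' r - Complex.I * κ * W r))‖ ≤ X := by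
      rw [norm_mul, norm_mul, norm_mul (Φ r), norm_pow, hnr]
      calc _ ≤ r ^ 2 * (K / ρ) * (c / r * (η / r)) := by
            gcongr; exacts [hs0 r hr, hΦ0 r hr, hW1 r hr]
        _ = X := by rw [hX]; field_simp
    have b4 : ‖(r : ℂ) * s' r * (Φ r * W r)‖ ≤ 2 * X := by
      rw [norm_mul, norm_mul, norm_mul (Φ r), hnr]
      calc _ ≤ (2 * ρ) * (K / ρ ^ 2) * (c / r * (η * r)) := by
            gcongr; exacts [hr.2, hs1 r hr, hΦ0 r hr, hW0 r hr]
        _ = 2 * X := by rw [hX]; field_simp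
    have b5 : ‖(r : ℂ) * s r * ((Φ' r - l * Φ r + Φ r / r) * W r)‖ ≤ X := by
      rw [norm_mul, norm_mul, norm_mul _ (W r), hnr]
      calc _ ≤ r * (K / ρ) * (c / r ^ 3 * (η * r)) := by
            gcongr; exacts [hs0 r hr, hΦ1 r hr, hW0 r hr]
        _ = X / r := by rw [hX]; field_simp
        _ ≤ X := div_le_self hX0 hr1
    have b6 : ‖(r : ℂ) * s r * (Φ r * (W' r - Complex.I * κ * W r))‖ ≤ X := by
      rw [norm_mul, norm_mul, norm_mul (Φ r), hnr]
      calc _ ≤ r * (K / ρ) * (c / r * (η / r)) := by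
            gcongr; exacts [hs0 r hr, hΦ0 r hr, hW1 r hr]
        _ = X / r := by rw [hX]; field_simp
        _ ≤ X := div_le_self hX0 hr1
    have hA : ‖(r : ℂ) ^ 2 * s r * (((l - Complex.I * κ) * Φ r) * W r
        + (Φ' r - l * Φ r + Φ r / r) * W r - Φ r * (W' r - Complex.I * κ * W r))‖ ≤ 3 * X := by
      rw [mul_sub, mul_add]
      refine (norm_sub_le _ _).trans ?_
      have := norm_add_le ((r : ℂ) ^ 2 * s r * (((l - Complex.I * κ) * Φ r) * W r))
        ((r : ℂ) ^ 2 * s r * ((Φ' r - l * Φ r + Φ r / r) * W r))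
      linarith
    have hB : ‖μ⁻¹ * ((r : ℂ) * s' r * (Φ r * W r)
        + (r : ℂ) * s r * ((Φ' r - l * Φ r + Φ r / r) * W r)
        + (r : ℂ) * s r * (Φ r * (W' r - Complex.I * κ * W r)))‖ ≤ ‖μ‖⁻¹ * (4 * X) := by
      rw [norm_mul, norm_inv]
      gcongr
      refine norm_add₃_le.trans ?_
      linarith
    calc ‖H' r‖ ≤ 3 * X + ‖μ‖⁻¹ * (4 * X) := (norm_add_le _ _).trans (add_le_add hA hB)
      _ = _ := by rw [div_eq_mul_inv]; ring
  have hmain := norm_image_sub_le_of_norm_deriv_right_le_segment (f := H) (f' := H') (a := ρ)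
    (b := 2 * ρ) (fun r hr => (hder r hr).continuousAt.continuousWithinAt)
    (fun r hr => (hder r (Set.Ico_subset_Icc_self hr)).hasDerivWithinAt)
    (fun r hr => hbd r (Set.Ico_subset_Icc_self hr)) (2 * ρ) ⟨by linarith, le_rfl⟩
  have e1 : H (2 * ρ) = ∫ t in ρ..2 * ρ, I t := by simp [hH, hG1, hG2, hsb]
  have e2 : H ρ = 0 := by simp [hH, hG1, hG2, hsa]
  rw [e1, e2, sub_zero] at hmain
  refine hmain.trans (le_of_eq ?_)
  rw [hX]; field_simp; ring

end RadialTail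

/-! ### Asymptotics along rays of the kernel centred at `x₀`. -/

section RayGeometry

variable {x₀ ν : E3} {r : ℝ}

lemma ray_dist_bounds (hν : ‖ν‖ = 1) (hr : 2 * ‖x₀‖ + 1 ≤ r) :
    r / 2 ≤ ‖r • ν - x₀‖ ∧ |‖r • ν - x₀‖ - r| ≤ ‖x₀‖ := by
  have hr0 : 0 ≤ r := by linarith [norm_nonneg x₀]
  have h1 : ‖r • ν‖ = r := by rw [norm_smul, hν, Real.norm_of_nonneg hr0, mul_one]
  have h2 := norm_sub_norm_le (r • ν) x₀
  have h3 := norm_sub_le (r • ν) x₀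
  rw [h1] at h2 h3
  refine ⟨by linarith [norm_nonneg x₀], abs_le.2 ⟨by linarith, by linarith⟩⟩

/-- The radial derivative of the distance to `x₀` along a ray. -/
noncomputable def rayDistDeriv (x₀ ν : E3) (r : ℝ) : ℝ := inner ℝ (r • ν - x₀) ν / ‖r • ν - x₀‖

lemma ray_ne (hν : ‖ν‖ = 1) (hr : 2 * ‖x₀‖ + 1 ≤ r) : r • ν ≠ x₀ := by
  have h := (ray_dist_bounds hν hr).1
  rintro h0
  rw [h0, sub_self, norm_zero] at h
  linarith [norm_nonneg x₀]

lemma hasDerivAt_ray_dist (hν : ‖ν‖ = 1) (hr : 2 * ‖x₀‖ + 1 ≤ r) :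
    HasDerivAt (fun t : ℝ => ‖t • ν - x₀‖) (rayDistDeriv x₀ ν r) r := by
  have h1 : HasDerivAt (fun t : ℝ => t • ν) ν r := by
    simpa using (hasDerivAt_id r).smul_const ν
  have := (hasFDerivAt_norm_sub (ray_ne hν hr)).comp_hasDerivAt r h1
  refine this.congr_deriv ?_
  rw [rayDistDeriv, div_eq_inv_mul]
  rfl

lemma continuousOn_rayDistDeriv (hν : ‖ν‖ = 1) :
    ContinuousOn (rayDistDeriv x₀ ν) (Set.Ioi (2 * ‖x₀‖ + 1)) := by
  unfold rayDistDeriv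
  refine ContinuousOn.div (by fun_prop) (by fun_prop) fun r hr => ?_
  exact norm_ne_zero_iff.2 (sub_ne_zero.2 (ray_ne hν (le_of_lt hr)))

lemma abs_rayDistDeriv_sub_one_le (hν : ‖ν‖ = 1) (hr : 2 * ‖x₀‖ + 1 ≤ r) :
    |rayDistDeriv x₀ ν r - 1| ≤ 4 * ‖x₀‖ ^ 2 / r ^ 2 := by
  obtain ⟨h1, -⟩ := ray_dist_bounds hν hr
  set N := ‖r • ν - x₀‖ with hN
  have ha := norm_nonneg x₀
  have hr0 : 0 < r := by linarith
  have hN0 : 0 < N := by linarith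
  set c := inner ℝ x₀ ν with hc
  have hcle : |c| ≤ ‖x₀‖ := by
    have := abs_real_inner_le_norm x₀ ν
    rwa [hν, mul_one] at this
  have hin : inner ℝ (r • ν - x₀) ν = r - c := by
    rw [inner_sub_left, inner_smul_left, real_inner_self_eq_norm_sq, hν]
    simp [hc]
  have hNsq : N ^ 2 = r ^ 2 - 2 * r * c + ‖x₀‖ ^ 2 := by
    rw [hN, norm_sub_sq_real, norm_smul, hν, inner_smul_left, real_inner_comm, ← hc]
    simp
    ring
  rw [rayDistDeriv, hin, ← hN]
  have hrc : 0 < r - c := by linarith [(abs_le.1 hcle).2]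
  -- The right side is the squared distance from `x₀` to the line of the ray, so `N - (r - c)` is
  -- `O(1/r)` and the derivative `(r - c)/N` is `1 + O(1/r²)`.
  have hprod : (N - (r - c)) * (N + (r - c)) = ‖x₀‖ ^ 2 - c ^ 2 := by linarith [hNsq]
  have hc2 : c ^ 2 ≤ ‖x₀‖ ^ 2 := by
    rw [← sq_abs c]; gcongr
  have hge : 0 ≤ N - (r - c) := by
    by_contra h
    push Not at h
    nlinarith
  have hle : (N - (r - c)) * N ≤ ‖x₀‖ ^ 2 := by nlinarith [sq_nonneg c]
  have e : (r - c) / N - 1 = -((N - (r - c)) / N) := by field_simp; ring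
  rw [e, abs_neg, abs_of_nonneg (by positivity), div_le_div_iff₀ hN0 (by positivity)]
  have h4 : r ^ 2 ≤ 4 * N ^ 2 := by nlinarith
  calc (N - (r - c)) * r ^ 2 ≤ (N - (r - c)) * (4 * N ^ 2) := by gcongr
    _ = 4 * ((N - (r - c)) * N) * N := by ring
    _ ≤ 4 * ‖x₀‖ ^ 2 * N := by gcongr

/-- The derivative of the Yukawa profile. -/
noncomputable def yukawaDeriv (l : ℂ) (r : ℝ) : ℂ := (l - 1 / r) * yukawa l r

lemma hasDerivAt_yukawa (l : ℂ) (hr : r ≠ 0) : HasDerivAt (yukawa l) (yukawaDeriv l r) r := by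
  have hr' : (r : ℂ) ≠ 0 := by exact_mod_cast hr
  have hpi : (Real.pi : ℂ) ≠ 0 := by exact_mod_cast Real.pi_ne_zero
  have hof : HasDerivAt (fun r : ℝ => (r : ℂ)) 1 r := Complex.ofRealCLM.hasDerivAt
  have h1 : HasDerivAt (fun r : ℝ => Complex.exp (l * r)) (Complex.exp (l * r) * (l * 1)) r :=
    (hof.const_mul l).cexp
  have h2 : HasDerivAt (fun r : ℝ => (4 * Real.pi * r : ℂ)) (4 * Real.pi * 1) r :=
    hof.const_mul _
  refine (h1.div h2 (by simp [hr, hpi])).congr_deriv ?_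
  rw [yukawaDeriv, yukawa]
  field_simp

lemma continuousOn_yukawa (l : ℂ) : ContinuousOn (yukawa l) {0}ᶜ := fun _ hr =>
  (hasDerivAt_yukawa l hr).continuousAt.continuousWithinAt

lemma continuousOn_yukawaDeriv (l : ℂ) : ContinuousOn (yukawaDeriv l) {0}ᶜ := by
  refine ContinuousOn.mul (continuousOn_const.sub (continuousOn_const.div
    Complex.continuous_ofReal.continuousOn fun _ hr => ?_)) (continuousOn_yukawa l)
  exact_mod_cast hr

lemma exists_ray_yukawa_bounds {κ : ℝ} {l : ℂ} (x₀ : E3) (hl0 : l.re ≤ 0)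
    (hl : l = Complex.I * κ ∨ l.re < 0) :
    ∃ c : ℝ, 0 ≤ c ∧ ∀ ν : E3, ‖ν‖ = 1 → ∀ r : ℝ, 2 * ‖x₀‖ + 1 ≤ r →
      ‖yukawa l ‖r • ν - x₀‖‖ ≤ c / r ∧
      ‖rayDistDeriv x₀ ν r * yukawaDeriv l ‖r • ν - x₀‖ - l * yukawa l ‖r • ν - x₀‖
        + yukawa l ‖r • ν - x₀‖ / r‖ ≤ c / r ^ 3 ∧
      ‖(l - Complex.I * κ) * yukawa l ‖r • ν - x₀‖‖ ≤ c / r ^ 3 := by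
  set a := ‖x₀‖ with ha
  have ha0 : 0 ≤ a := norm_nonneg _
  -- Either the prefactor vanishes (`l = iκ`), or the kernel decays exponentially and `t²/2 ≤ e^t`
  -- supplies the two extra powers of `1/N`.
  obtain ⟨b, hb0, hb⟩ : ∃ b : ℝ, 0 ≤ b ∧ ∀ N : ℝ, 0 < N →
      ‖(l - Complex.I * κ) * yukawa l N‖ ≤ b / N ^ 3 := by
    rcases hl with h | h
    · exact ⟨0, le_rfl, fun N hN => by simp [h]⟩
    · refine ⟨‖l - Complex.I * κ‖ * (2 / l.re ^ 2), by positivity, fun N hN => ?_⟩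
      rw [norm_mul, mul_div_assoc]
      gcongr
      rw [norm_yukawa l hN.le]
      have hpi : 1 ≤ 4 * Real.pi := by linarith [Real.pi_gt_three]
      have hpos : 0 < -l.re * N := mul_pos (by linarith) hN
      have h1 := Real.quadratic_le_exp_of_nonneg hpos.le
      have h2 : Real.exp (l.re * N) ≤ 2 / (l.re ^ 2 * N ^ 2) := by
        have : Real.exp (l.re * N) = (Real.exp (-l.re * N))⁻¹ := by rw [← Real.exp_neg]; ring_nf
        rw [this, inv_le_comm₀ (Real.exp_pos _) (by have := h.ne; positivity), inv_div]
        nlinarith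
      have hne := h.ne
      calc Real.exp (l.re * N) / (4 * Real.pi * N)
          ≤ (2 / (l.re ^ 2 * N ^ 2)) / (1 * N) := by gcongr
        _ = 2 / l.re ^ 2 / N ^ 3 := by field_simp
  refine ⟨2 + 2 * (‖l‖ * (4 * a ^ 2) + 2 * a + 8 * a ^ 2) + 8 * b, by positivity,
    fun ν hν r hr => ?_⟩
  obtain ⟨h1, h2⟩ := ray_dist_bounds hν hr
  have h3 := abs_rayDistDeriv_sub_one_le hν hr
  set N := ‖r • ν - x₀‖ with hN
  set d := rayDistDeriv x₀ ν r with hd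
  have hr1 : 1 ≤ r := by linarith
  have hr0 : 0 < r := by linarith
  have hN0 : 0 < N := by linarith
  have hΦ : ‖yukawa l N‖ ≤ 2 / r := by
    rw [norm_yukawa l hN0.le]
    have hpi : 1 ≤ 4 * Real.pi := by linarith [Real.pi_gt_three]
    have : Real.exp (l.re * N) ≤ 1 := Real.exp_le_one_iff.2 (by nlinarith)
    calc Real.exp (l.re * N) / (4 * Real.pi * N) ≤ 1 / (1 * (r / 2)) := by gcongr
      _ = 2 / r := by field_simp
  have hL : 0 ≤ 2 * (‖l‖ * (4 * a ^ 2) + 2 * a + 8 * a ^ 2) := by positivity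
  refine ⟨hΦ.trans (div_le_div_of_nonneg_right (by linarith) hr0.le), ?_, ?_⟩
  · have hrC : (r : ℂ) ≠ 0 := by exact_mod_cast hr0.ne'
    have hNC : (N : ℂ) ≠ 0 := by exact_mod_cast hN0.ne'
    have e : (d : ℂ) * yukawaDeriv l N - l * yukawa l N + yukawa l N / r
        = (l * ((d - 1 : ℝ) : ℂ) + ((1 / r - 1 / N : ℝ) : ℂ) - (((d - 1) / N : ℝ) : ℂ))
          * yukawa l N := by
      rw [yukawaDeriv]; push_cast; field_simp; ring
    rw [e, norm_mul]
    have b1 : ‖l * ((d - 1 : ℝ) : ℂ)‖ ≤ ‖l‖ * (4 * a ^ 2) / r ^ 2 := by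
      rw [norm_mul, Complex.norm_real, Real.norm_eq_abs, mul_div_assoc]; gcongr
    have b2 : ‖((1 / r - 1 / N : ℝ) : ℂ)‖ ≤ 2 * a / r ^ 2 := by
      rw [Complex.norm_real, Real.norm_eq_abs]
      have : 1 / r - 1 / N = (N - r) / (r * N) := by field_simp
      rw [this, abs_div, abs_of_pos (mul_pos hr0 hN0)]
      calc |N - r| / (r * N) ≤ a / (r * (r / 2)) := by gcongr
        _ = 2 * a / r ^ 2 := by field_simp
    have b3 : ‖(((d - 1) / N : ℝ) : ℂ)‖ ≤ 8 * a ^ 2 / r ^ 2 := by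
      rw [Complex.norm_real, Real.norm_eq_abs, abs_div, abs_of_pos hN0]
      calc |d - 1| / N ≤ (4 * a ^ 2 / r ^ 2) / (1 / 2) := by gcongr; linarith
        _ = 8 * a ^ 2 / r ^ 2 := by ring
    have b4 : ‖l * ((d - 1 : ℝ) : ℂ) + ((1 / r - 1 / N : ℝ) : ℂ) - (((d - 1) / N : ℝ) : ℂ)‖
        ≤ (‖l‖ * (4 * a ^ 2) + 2 * a + 8 * a ^ 2) / r ^ 2 := by
      refine (norm_sub_le _ _).trans ?_
      have := norm_add_le (l * ((d - 1 : ℝ) : ℂ)) ((1 / r - 1 / N : ℝ) : ℂ)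
      rw [add_div, add_div]
      linarith
    calc _ ≤ (‖l‖ * (4 * a ^ 2) + 2 * a + 8 * a ^ 2) / r ^ 2 * (2 / r) := by gcongr
      _ = 2 * (‖l‖ * (4 * a ^ 2) + 2 * a + 8 * a ^ 2) / r ^ 3 := by field_simp
      _ ≤ _ := by gcongr; linarith
  · refine (hb N hN0).trans ?_
    calc b / N ^ 3 ≤ b / (r / 2) ^ 3 := by gcongr
      _ = 8 * b / r ^ 3 := by field_simp; ring
      _ ≤ _ := by
        gcongr
        linarith

end RayGeometry

/-! ### The smooth step and its derivatives. -/

section Step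

/-- A smooth step, equal to `0` on `(-∞, 1]` and to `1` on `[2, ∞)`. -/
noncomputable def step (t : ℝ) : ℂ := (Real.smoothTransition (t - 1) : ℝ)

lemma contDiff_step : ContDiff ℝ ∞ step := by
  have h : ContDiff ℝ ∞ Real.smoothTransition := Real.smoothTransition.contDiff
  exact Complex.ofRealCLM.contDiff.comp (h.comp (contDiff_id.sub contDiff_const))

lemma step_of_le_one {t : ℝ} (h : t ≤ 1) : step t = 0 := by
  rw [step, Real.smoothTransition.zero_of_nonpos (by linarith)]; simp

lemma step_of_two_le {t : ℝ} (h : 2 ≤ t) : step t = 1 := by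
  rw [step, Real.smoothTransition.one_of_one_le (by linarith)]; simp

lemma norm_step_le_one (t : ℝ) : ‖step t‖ ≤ 1 := by
  rw [step, Complex.norm_real, Real.norm_of_nonneg (Real.smoothTransition.nonneg _)]
  exact Real.smoothTransition.le_one _

lemma norm_one_sub_step_le_one (t : ℝ) : ‖1 - step t‖ ≤ 1 := by
  have h1 := Real.smoothTransition.nonneg (t - 1)
  have h2 := Real.smoothTransition.le_one (t - 1)
  rw [step, ← Complex.ofReal_one, ← Complex.ofReal_sub, Complex.norm_real,
    Real.norm_of_nonneg (by linarith)]
  linarith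

lemma contDiff_deriv_step : ContDiff ℝ ∞ (deriv step) := contDiff_step.deriv'

lemma continuous_deriv_deriv_step : Continuous (deriv (deriv step)) :=
  (ContDiff.deriv' (n := ∞) contDiff_deriv_step).continuous

/-- Continuity of the derivative brings in the endpoints `1` and `2`, where the boundary terms of
the integrations by parts must vanish. -/
lemma deriv_eq_zero_off_Icc {g : ℝ → ℂ} {a b : ℂ} (hg : Continuous (deriv g))
    (h1 : ∀ t ≤ 1, g t = a) (h2 : ∀ t, 2 ≤ t → g t = b) :
    (∀ t ≤ 1, deriv g t = 0) ∧ ∀ t, 2 ≤ t → deriv g t = 0 := by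
  have k1 : Set.EqOn (deriv g) 0 (Set.Iio 1) := fun t ht => by
    have : g =ᶠ[𝓝 t] fun _ => a := by
      filter_upwards [Iio_mem_nhds ht] with s hs using h1 s hs.le
    simp [this.deriv_eq]
  have k2 : Set.EqOn (deriv g) 0 (Set.Ioi 2) := fun t ht => by
    have : g =ᶠ[𝓝 t] fun _ => b := by
      filter_upwards [Ioi_mem_nhds ht] with s hs using h2 s hs.le
    simp [this.deriv_eq]
  have k1' := k1.closure hg continuous_zero
  have k2' := k2.closure hg continuous_zero
  rw [closure_Iio] at k1'
  rw [closure_Ioi] at k2'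
  exact ⟨fun t ht => k1' ht, fun t ht => k2' ht⟩

lemma deriv_step_eq_zero : (∀ t ≤ 1, deriv step t = 0) ∧ ∀ t, 2 ≤ t → deriv step t = 0 :=
  deriv_eq_zero_off_Icc contDiff_deriv_step.continuous (fun _ => step_of_le_one)
    fun _ => step_of_two_le

lemma deriv_deriv_step_eq_zero :
    (∀ t ≤ 1, deriv (deriv step) t = 0) ∧ ∀ t, 2 ≤ t → deriv (deriv step) t = 0 :=
  deriv_eq_zero_off_Icc continuous_deriv_deriv_step deriv_step_eq_zero.1 deriv_step_eq_zero.2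

lemma hasDerivAt_step (t : ℝ) : HasDerivAt step (deriv step t) t :=
  (contDiff_step.differentiable (by norm_num) t).hasDerivAt

lemma hasDerivAt_deriv_step (t : ℝ) : HasDerivAt (deriv step) (deriv (deriv step) t) t :=
  (contDiff_deriv_step.differentiable (by norm_num) t).hasDerivAt

lemma exists_bound_deriv_step :
    ∃ K : ℝ, 0 ≤ K ∧ ∀ t, ‖deriv step t‖ ≤ K ∧ ‖deriv (deriv step) t‖ ≤ K := by
  have key : ∀ g : ℝ → ℂ, Continuous g → (∀ t ≤ 1, g t = 0) → (∀ t, 2 ≤ t → g t = 0) →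
      ∃ K : ℝ, ∀ t, ‖g t‖ ≤ K := fun g hg h1 h2 =>
    (HasCompactSupport.intro (isCompact_Icc (a := (1 : ℝ)) (b := 2)) fun t ht => by
      by_cases h : t ≤ 1
      · exact h1 t h
      · exact h2 t (by
          by_contra h'
          exact ht ⟨by linarith, by linarith⟩)).exists_bound_of_continuous hg
  obtain ⟨K1, h1⟩ := key _ contDiff_deriv_step.continuous deriv_step_eq_zero.1 deriv_step_eq_zero.2
  obtain ⟨K2, h2⟩ := key _ continuous_deriv_deriv_step deriv_deriv_step_eq_zero.1
    deriv_deriv_step_eq_zero.2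
  exact ⟨max K1 K2, (norm_nonneg _).trans ((h1 0).trans (le_max_left _ _)),
    fun t => ⟨(h1 t).trans (le_max_left _ _), (h2 t).trans (le_max_right _ _)⟩⟩

lemma hasDerivAt_step_div {a : ℝ} (t : ℝ) :
    HasDerivAt (fun t => step (t / a)) ((a : ℂ)⁻¹ * deriv step (t / a)) t := by
  have h := (hasDerivAt_step (t / a)).scomp t ((hasDerivAt_id t).div_const a)
  refine h.congr_deriv ?_
  simp [Complex.real_smul]

lemma hasDerivAt_deriv_step_div {a : ℝ} (t : ℝ) :
    HasDerivAt (fun t => deriv step (t / a)) ((a : ℂ)⁻¹ * deriv (deriv step) (t / a)) t := by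
  have h := (hasDerivAt_deriv_step (t / a)).scomp t ((hasDerivAt_id t).div_const a)
  refine h.congr_deriv ?_
  simp [Complex.real_smul]

end Step

/-! ### The truncated kernel and its defects. -/

section TestFunction

lemma hasDerivAt_yukawaDeriv (l : ℂ) {r : ℝ} (hr : r ≠ 0) :
    HasDerivAt (yukawaDeriv l) ((l ^ 2 - 2 * l / r + 2 / r ^ 2) * yukawa l r) r := by
  have hr' : (r : ℂ) ≠ 0 := by exact_mod_cast hr
  have hof : HasDerivAt (fun r : ℝ => (r : ℂ)) 1 r := Complex.ofRealCLM.hasDerivAt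
  have h1 : HasDerivAt (fun r : ℝ => (1 / r : ℂ)) ((0 * (r : ℂ) - 1 * 1) / (r : ℂ) ^ 2) r :=
    (hasDerivAt_const r (1 : ℂ)).div hof hr'
  refine ((h1.const_sub l).mul (hasDerivAt_yukawa l hr)).congr_deriv ?_
  rw [yukawaDeriv]
  field_simp
  ring

lemma contDiffAt_yukawa (l : ℂ) {r : ℝ} (hr : r ≠ 0) {n : ℕ∞ω} :
    ContDiffAt ℝ n (yukawa l) r := by
  have hof : ContDiffAt ℝ n (fun r : ℝ => (r : ℂ)) r := Complex.ofRealCLM.contDiff.contDiffAt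
  have : yukawa l = fun r : ℝ => Complex.exp (l * r) * ((4 * Real.pi * r : ℂ))⁻¹ :=
    funext fun r => div_eq_mul_inv _ _
  rw [this]
  refine ContDiffAt.mul ?_ (ContDiffAt.inv (contDiffAt_const.mul hof) ?_)
  · exact (contDiffAt_const.mul hof).cexp
  · have hpi : (Real.pi : ℂ) ≠ 0 := by exact_mod_cast Real.pi_ne_zero
    simp [hr, hpi]

/-- The Yukawa profile, cut off near the origin. -/
noncomputable def cutYukawa (l : ℂ) (δ r : ℝ) : ℂ := step (r / δ) * yukawa l r

/-- The defect `(Δ - l²)` of `cutYukawa`. -/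
noncomputable def nearDefect (l : ℂ) (δ r : ℝ) : ℂ :=
  ((δ : ℂ)⁻¹ ^ 2 * deriv (deriv step) (r / δ) + 2 * l * (δ : ℂ)⁻¹ * deriv step (r / δ))
    * yukawa l r

variable {l : ℂ} {δ ρ : ℝ} {x₀ x : E3}

lemma eventually_norm_sub_lt_of_lt {c x : E3} {a : ℝ} (h : ‖x - c‖ < a) : ∀ᶠ y in 𝓝 x, ‖y - c‖ < a := by
  have : Continuous fun y : E3 => ‖y - c‖ := by fun_prop
  exact this.continuousAt.eventually_lt continuousAt_const h

lemma eventually_lt_norm_sub_of_lt {c x : E3} {a : ℝ} (h : a < ‖x - c‖) : ∀ᶠ y in 𝓝 x, a < ‖y - c‖ := by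
  have : Continuous fun y : E3 => ‖y - c‖ := by fun_prop
  exact continuousAt_const.eventually_lt this.continuousAt h

lemma contDiff_cutYukawa (hδ : 0 < δ) : ContDiff ℝ ∞ fun y : E3 => cutYukawa l δ ‖y - x₀‖ := by
  rw [contDiff_iff_contDiffAt]
  intro y
  by_cases hy : ‖y - x₀‖ < δ
  · refine (contDiffAt_const (c := (0 : ℂ))).congr_of_eventuallyEq ?_
    filter_upwards [eventually_norm_sub_lt_of_lt hy] with z hz
    rw [cutYukawa, step_of_le_one ((div_le_one hδ).2 hz.le), zero_mul]
  · have h0 : 0 < ‖y - x₀‖ := by linarith [not_lt.1 hy]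
    refine contDiffAt_radial (sub_ne_zero.1 (norm_pos_iff.1 h0)) ?_
    exact ((contDiff_step.comp (contDiff_id.div_const δ)).contDiffAt).mul
      (contDiffAt_yukawa l h0.ne')

lemma contDiff_cutoff (hρ : 0 < ρ) : ContDiff ℝ ∞ fun y : E3 => 1 - step (‖y‖ / ρ) := by
  rw [contDiff_iff_contDiffAt]
  intro y
  by_cases hy : ‖y‖ < ρ
  · refine (contDiffAt_const (c := (1 : ℂ))).congr_of_eventuallyEq ?_
    have hy' : ‖y - 0‖ < ρ := by simpa using hy
    filter_upwards [eventually_norm_sub_lt_of_lt hy'] with z hz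
    rw [sub_zero] at hz
    rw [step_of_le_one ((div_le_one hρ).2 hz.le), sub_zero]
  · have h0 : 0 < ‖y‖ := by linarith [not_lt.1 hy]
    have h1 : ContDiffAt ℝ ∞ (fun y : E3 => ‖y‖) y := contDiffAt_norm ℝ (norm_pos_iff.1 h0)
    exact contDiffAt_const.sub (contDiff_step.contDiffAt.comp y (h1.div_const ρ))

lemma laplacian_yukawa (hx : x ≠ x₀) :
    Δ (fun y : E3 => yukawa l ‖y - x₀‖) x = l ^ 2 * yukawa l ‖x - x₀‖ := by
  have hN : ‖x - x₀‖ ≠ 0 := norm_ne_zero_iff.2 (sub_ne_zero.2 hx)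
  rw [laplacian_radial hx (contDiffAt_yukawa l hN)]
  set N := ‖x - x₀‖
  have hN' : (N : ℂ) ≠ 0 := by exact_mod_cast hN
  have h1 : deriv (yukawa l) =ᶠ[𝓝 N] yukawaDeriv l := by
    filter_upwards [eventually_ne_nhds hN] with r hr using (hasDerivAt_yukawa l hr).deriv
  rw [h1.deriv_eq, (hasDerivAt_yukawaDeriv l hN).deriv, (hasDerivAt_yukawa l hN).deriv, yukawaDeriv]
  field_simp
  ring

/-- A radial function satisfies `Δg = (rg)''/r`, and here `rg` is a constant times `χ(r/δ) e^{lr}`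
with `χ` the step. Only `χ''` and `2lχ'` survive. -/
lemma laplacian_cutYukawa (hδ : 0 < δ) (x : E3) :
    Δ (fun y : E3 => cutYukawa l δ ‖y - x₀‖) x - l ^ 2 * cutYukawa l δ ‖x - x₀‖
      = nearDefect l δ ‖x - x₀‖ := by
  by_cases hx : x = x₀
  · have h0 : (fun y : E3 => cutYukawa l δ ‖y - x₀‖) =ᶠ[𝓝 x] fun _ => 0 := by
      have : ‖x - x₀‖ < δ := by simpa [hx] using hδ
      filter_upwards [eventually_norm_sub_lt_of_lt this] with z hz
      rw [cutYukawa, step_of_le_one ((div_le_one hδ).2 hz.le), zero_mul]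
    rw [(InnerProductSpace.laplacian_congr_nhds h0).eq_of_nhds, InnerProductSpace.laplacian_const]
    -- At the centre `yukawa l 0 = 0`, by division by zero.
    simp [hx, cutYukawa, nearDefect, yukawa]
  have hN : ‖x - x₀‖ ≠ 0 := norm_ne_zero_iff.2 (sub_ne_zero.2 hx)
  have hc : ∀ r : ℝ, r ≠ 0 → ContDiffAt ℝ 2 (cutYukawa l δ) r := fun r hr =>
    (((contDiff_step.comp (contDiff_id.div_const δ)).contDiffAt).of_le (by norm_cast)).mul
      (contDiffAt_yukawa l hr)
  rw [laplacian_radial hx (hc _ hN)]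
  set N := ‖x - x₀‖
  have hN' : (N : ℂ) ≠ 0 := by exact_mod_cast hN
  have hδ' : (δ : ℂ) ≠ 0 := by exact_mod_cast hδ.ne'
  have d1 : ∀ r : ℝ, r ≠ 0 → HasDerivAt (cutYukawa l δ)
      ((δ : ℂ)⁻¹ * deriv step (r / δ) * yukawa l r + step (r / δ) * yukawaDeriv l r) r :=
    fun r hr => (hasDerivAt_step_div r).mul (hasDerivAt_yukawa l hr)
  have h1 : deriv (cutYukawa l δ) =ᶠ[𝓝 N] fun r =>
      (δ : ℂ)⁻¹ * deriv step (r / δ) * yukawa l r + step (r / δ) * yukawaDeriv l r := by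
    filter_upwards [eventually_ne_nhds hN] with r hr using (d1 r hr).deriv
  have d2 := ((((hasDerivAt_deriv_step_div (a := δ) N).const_mul (δ : ℂ)⁻¹).mul
    (hasDerivAt_yukawa l hN)).add ((hasDerivAt_step_div (a := δ) N).mul
      (hasDerivAt_yukawaDeriv l hN))).deriv
  rw [h1.deriv_eq, h1.eq_of_nhds]
  refine (congrArg (fun z => z + _ - _) d2).trans ?_
  rw [cutYukawa, nearDefect, yukawaDeriv]
  field_simp
  ring

/-- The first derivative of the radial cutoff at radius `ρ`. -/
noncomputable def cutDeriv (ρ r : ℝ) : ℂ := -((ρ : ℂ)⁻¹ * deriv step (r / ρ))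

/-- The second derivative of the radial cutoff at radius `ρ`. -/
noncomputable def cutDeriv2 (ρ r : ℝ) : ℂ := -((ρ : ℂ)⁻¹ * ((ρ : ℂ)⁻¹ * deriv (deriv step) (r / ρ)))

lemma hasDerivAt_cutDeriv (r : ℝ) : HasDerivAt (cutDeriv ρ) (cutDeriv2 ρ r) r :=
  ((hasDerivAt_deriv_step_div r).const_mul _).neg

lemma hasDerivAt_cut (r : ℝ) : HasDerivAt (fun r => 1 - step (r / ρ)) (cutDeriv ρ r) r :=
  (hasDerivAt_step_div r).const_sub 1

/-- The commutator of `Δ` with the cutoff, applied to the Yukawa kernel centred at `x₀`. -/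
noncomputable def farDefect (l : ℂ) (ρ : ℝ) (x₀ x : E3) : ℂ :=
  (cutDeriv2 ρ ‖x‖ + 2 / ‖x‖ * cutDeriv ρ ‖x‖) * yukawa l ‖x - x₀‖
    + 2 * (cutDeriv ρ ‖x‖ * ((inner ℝ (x - x₀) (‖x‖⁻¹ • x) / ‖x - x₀‖ : ℝ)
      * yukawaDeriv l ‖x - x₀‖))

/-- The test function: the Yukawa kernel centred at `x₀`, cut off at radii `δ` and `ρ`. -/
noncomputable def testFun (l : ℂ) (δ ρ : ℝ) (x₀ x : E3) : ℂ :=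
  (1 - step (‖x‖ / ρ)) * cutYukawa l δ ‖x - x₀‖

lemma contDiff_testFun (hδ : 0 < δ) (hρ : 0 < ρ) : ContDiff ℝ ∞ (testFun l δ ρ x₀) :=
  (contDiff_cutoff hρ).mul (contDiff_cutYukawa hδ)

lemma hasCompactSupport_testFun (hρ : 0 < ρ) : HasCompactSupport (testFun l δ ρ x₀) := by
  refine HasCompactSupport.intro (isCompact_closedBall (0 : E3) (2 * ρ)) fun y hy => ?_
  have : 2 * ρ < ‖y‖ := by simpa using hy
  rw [testFun, step_of_two_le ((le_div_iff₀ hρ).2 this.le), sub_self, zero_mul]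

/-- The condition on `δ` and `ρ` keeps the two transition zones apart: for `‖x‖ < ρ` the outer
cutoff is `1`, elsewhere the inner one is, so no cross terms appear. -/
lemma laplacian_testFun (hδ : 0 < δ) (hδρ : ‖x₀‖ + 2 * δ < ρ) (x : E3) :
    Δ (testFun l δ ρ x₀) x - l ^ 2 * testFun l δ ρ x₀ x
      = nearDefect l δ ‖x - x₀‖ + farDefect l ρ x₀ x := by
  have ha := norm_nonneg x₀
  have hρ : 0 < ρ := by linarith
  by_cases hx : ‖x‖ < ρ
  · have hx' : ‖x - 0‖ < ρ := by simpa using hx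
    have h0 : testFun l δ ρ x₀ =ᶠ[𝓝 x] fun y => cutYukawa l δ ‖y - x₀‖ := by
      filter_upwards [eventually_norm_sub_lt_of_lt hx'] with z hz
      rw [sub_zero] at hz
      rw [testFun, step_of_le_one ((div_le_one hρ).2 hz.le), sub_zero, one_mul]
    rw [(InnerProductSpace.laplacian_congr_nhds h0).eq_of_nhds, h0.eq_of_nhds,
      laplacian_cutYukawa hδ]
    have h1 : ‖x‖ / ρ ≤ 1 := (div_le_one hρ).2 hx.le
    simp [farDefect, cutDeriv, cutDeriv2, deriv_step_eq_zero.1 _ h1,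
      deriv_deriv_step_eq_zero.1 _ h1]
  push Not at hx
  have hx0 : x ≠ 0 := norm_pos_iff.1 (hρ.trans_le hx)
  have hN2 : 2 * δ < ‖x - x₀‖ := by linarith [norm_sub_norm_le x x₀]
  have hN0 : 0 < ‖x - x₀‖ := by linarith
  have hxx : x ≠ x₀ := sub_ne_zero.1 (norm_pos_iff.1 hN0)
  have h0 : testFun l δ ρ x₀ =ᶠ[𝓝 x] fun y => (1 - step (‖y‖ / ρ)) * yukawa l ‖y - x₀‖ := by
    filter_upwards [eventually_lt_norm_sub_of_lt hN2] with z hz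
    rw [testFun, cutYukawa, step_of_two_le ((le_div_iff₀ hδ).2 hz.le), one_mul]
  have hcut : (fun y : E3 => 1 - step (‖y‖ / ρ))
      = fun y => (fun r => 1 - step (r / ρ)) ‖y - 0‖ := by simp
  have c1 : ContDiffAt ℝ 2 (fun r => 1 - step (r / ρ)) ‖x - 0‖ :=
    contDiffAt_const.sub (((contDiff_step.comp (contDiff_id.div_const ρ)).contDiffAt).of_le
      (by norm_cast))
  have e1 : Δ (fun y : E3 => 1 - step (‖y‖ / ρ)) x
      = cutDeriv2 ρ ‖x‖ + 2 / ‖x‖ * cutDeriv ρ ‖x‖ := by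
    have hd : deriv (fun r => 1 - step (r / ρ)) = cutDeriv ρ :=
      funext fun r => (hasDerivAt_cut r).deriv
    rw [hcut, laplacian_radial hx0 c1, hd, (hasDerivAt_cutDeriv _).deriv, sub_zero]
  have e2 : ∑ i, fderiv ℝ (fun y : E3 => 1 - step (‖y‖ / ρ)) x (stdBasis i)
      * fderiv ℝ (fun y : E3 => yukawa l ‖y - x₀‖) x (stdBasis i)
      = cutDeriv ρ ‖x‖ * ((inner ℝ (x - x₀) (‖x‖⁻¹ • x) / ‖x - x₀‖ : ℝ)
      * yukawaDeriv l ‖x - x₀‖) := by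
    rw [hcut, (hasFDerivAt_radial hx0 (hasDerivAt_cut _)).fderiv,
      (hasFDerivAt_radial hxx (hasDerivAt_yukawa l hN0.ne')).fderiv, inner_smul_right,
      ← OrthonormalBasis.sum_inner_mul_inner stdBasis (x - x₀) x]
    simp [EuclideanSpace.inner_single_right, EuclideanSpace.inner_single_left,
      Fin.sum_univ_three]
    ring
  rw [(InnerProductSpace.laplacian_congr_nhds h0).eq_of_nhds, h0.eq_of_nhds,
    laplacian_mul ((contDiff_cutoff hρ).contDiffAt.of_le (by norm_cast))
      (contDiffAt_radial hxx (contDiffAt_yukawa l hN0.ne')), laplacian_yukawa hxx, e1, e2]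
  have h2 : 2 ≤ ‖x - x₀‖ / δ := (le_div_iff₀ hδ).2 hN2.le
  simp only [nearDefect, farDefect, deriv_step_eq_zero.2 _ h2, deriv_deriv_step_eq_zero.2 _ h2]
  ring

end TestFunction

/-! ### Removing the inner cutoff. -/

section Limits

/-- The integrand has primitive `r χ' - χ`. This is the mass that makes the inner defect converge to
minus the Dirac mass at `x₀`. -/
lemma integral_Ioi_mul_deriv_deriv_step :
    ∫ r in Set.Ioi (0 : ℝ), (r : ℂ) * deriv (deriv step) r = -1 := by
  have h1 : ∫ r in Set.Ioi (0 : ℝ), (r : ℂ) * deriv (deriv step) r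
      = ∫ r in Set.Ioc (1 : ℝ) 2, (r : ℂ) * deriv (deriv step) r := by
    refine setIntegral_eq_of_subset_of_forall_sdiff_eq_zero measurableSet_Ioi
      (fun r hr => Set.mem_Ioi.2 (by linarith [hr.1])) fun r hr => ?_
    by_cases h : r ≤ 1
    · rw [deriv_deriv_step_eq_zero.1 r h, mul_zero]
    · have : 2 ≤ r := by
        by_contra h'
        exact hr.2 ⟨not_le.1 h, (not_le.1 h').le⟩
      rw [deriv_deriv_step_eq_zero.2 r this, mul_zero]
  rw [h1, ← intervalIntegral.integral_of_le (by norm_num)]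
  have hd : ∀ r : ℝ, HasDerivAt (fun r : ℝ => (r : ℂ) * deriv step r - step r)
      ((r : ℂ) * deriv (deriv step) r) r := fun r => by
    have hof : HasDerivAt (fun r : ℝ => (r : ℂ)) 1 r := Complex.ofRealCLM.hasDerivAt
    refine ((hof.mul (hasDerivAt_deriv_step r)).sub (hasDerivAt_step r)).congr_deriv ?_
    ring
  rw [intervalIntegral.integral_eq_sub_of_hasDerivAt (fun r _ => hd r)
    ((Complex.continuous_ofReal.mul continuous_deriv_deriv_step).intervalIntegrable _ _)]
  simp [deriv_step_eq_zero.1 1 le_rfl, deriv_step_eq_zero.2 2 le_rfl, step_of_le_one le_rfl,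
    step_of_two_le le_rfl]

lemma integral_deriv_deriv_step_norm :
    ∫ z : E3, deriv (deriv step) ‖z‖ * (4 * Real.pi * (max ‖z‖ 1 : ℝ) : ℂ)⁻¹ = -1 := by
  rw [integral_fun_norm_addHaar (volume : Measure E3)
    (fun r : ℝ => deriv (deriv step) r * (4 * Real.pi * (max r 1 : ℝ) : ℂ)⁻¹)]
  have hpi : (Real.pi : ℂ) ≠ 0 := by exact_mod_cast Real.pi_ne_zero
  have h1 : ∫ r in Set.Ioi (0 : ℝ), r ^ (Module.finrank ℝ E3 - 1) •
      (deriv (deriv step) r * (4 * Real.pi * (max r 1 : ℝ) : ℂ)⁻¹)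
      = ∫ r in Set.Ioi (0 : ℝ), (4 * Real.pi : ℂ)⁻¹ * ((r : ℂ) * deriv (deriv step) r) := by
    refine setIntegral_congr_fun measurableSet_Ioi fun r hr => ?_
    have hr : 0 < r := hr
    by_cases h : r ≤ 1
    · simp [deriv_deriv_step_eq_zero.1 r h]
    · have hr' : (r : ℂ) ≠ 0 := by exact_mod_cast hr.ne'
      simp only [max_eq_left (not_le.1 h).le, finrank_euclideanSpace, Fintype.card_fin,
        Complex.real_smul]
      push_cast
      field_simp
  have h2 : (volume : Measure E3).real (Metric.ball 0 1) = Real.pi * 4 / 3 := by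
    rw [measureReal_def, EuclideanSpace.volume_ball_fin_three]
    simp
    positivity
  rw [h1, integral_const_mul, integral_Ioi_mul_deriv_deriv_step, h2]
  simp [Complex.real_smul]
  field_simp

lemma tendsto_integral_nearDefect {w : E3 → ℂ} (hw : Continuous w) (l : ℂ) (x₀ : E3) :
    Tendsto (fun δ : ℝ => ∫ y, w y * nearDefect l δ ‖y - x₀‖) (𝓝[>] 0) (𝓝 (-w x₀)) := by
  -- The integrand after `y = x₀ + δz`; the Jacobian `δ³` cancels `δ⁻²` from `χ''` and `δ⁻¹` from
  -- the kernel. `max ‖z‖ 1` equals `‖z‖` wherever the derivatives of the step are nonzero, and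
  -- makes `H` continuous at `z = 0` as well as at `δ = 0`.
  set H : ℝ → E3 → ℂ := fun δ z => w (x₀ + δ • z) *
    ((deriv (deriv step) ‖z‖ + 2 * l * δ * deriv step ‖z‖) * Complex.exp (l * δ * ‖z‖)
      * (4 * Real.pi * (max ‖z‖ 1 : ℝ) : ℂ)⁻¹) with hH
  have hpi : (Real.pi : ℂ) ≠ 0 := by exact_mod_cast Real.pi_ne_zero
  have hcont : Continuous (Function.uncurry H) := by
    have c1 := continuous_deriv_deriv_step
    have c2 := contDiff_deriv_step.continuous
    simp only [hH, Function.uncurry_def]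
    refine Continuous.mul (by fun_prop) (Continuous.mul (by fun_prop) (Continuous.inv₀
      (by fun_prop) fun p => ?_))
    have : (0 : ℝ) < max ‖p.2‖ 1 := lt_of_lt_of_le one_pos (le_max_right _ _)
    have : ((max ‖p.2‖ 1 : ℝ) : ℂ) ≠ 0 := by exact_mod_cast this.ne'
    simp only [ne_eq, mul_eq_zero, hpi, this]
    norm_num
  have hsupp : ∀ δ, ∫ z in Metric.closedBall (0 : E3) 2, H δ z = ∫ z, H δ z := fun δ => by
    refine setIntegral_eq_integral_of_forall_compl_eq_zero fun z hz => ?_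
    have : 2 ≤ ‖z‖ := by
      have : 2 < ‖z‖ := by simpa using hz
      exact this.le
    simp [hH, deriv_step_eq_zero.2 _ this, deriv_deriv_step_eq_zero.2 _ this]
  have hlim : Tendsto (fun δ : ℝ => ∫ z, H δ z) (𝓝[>] 0) (𝓝 (∫ z, H 0 z)) := by
    simp only [← hsupp]
    exact ((continuous_parametric_integral_of_continuous hcont
      (isCompact_closedBall (0 : E3) 2)).tendsto 0).mono_left nhdsWithin_le_nhds
  have h0 : ∫ z, H 0 z = -w x₀ := by
    simp only [hH, zero_smul, add_zero, Complex.ofReal_zero, mul_zero, zero_mul, Complex.exp_zero,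
      mul_one]
    rw [integral_const_mul, integral_deriv_deriv_step_norm, mul_neg_one]
  rw [← h0]
  refine hlim.congr' ?_
  filter_upwards [self_mem_nhdsWithin] with δ hδ
  have hδ : 0 < δ := hδ
  have hδ' : (δ : ℂ) ≠ 0 := by exact_mod_cast hδ.ne'
  have e1 : ∫ y, w y * nearDefect l δ ‖y - x₀‖ = ∫ y, w (x₀ + y) * nearDefect l δ ‖y‖ := by
    rw [← integral_sub_right_eq_self (fun y => w (x₀ + y) * nearDefect l δ ‖y‖) x₀]
    simp
  have e2 := Measure.integral_comp_smul (volume : Measure E3)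
    (fun y => w (x₀ + y) * nearDefect l δ ‖y‖) δ
  have e3 : ∫ y, w (x₀ + y) * nearDefect l δ ‖y‖
      = (δ : ℂ) ^ 3 * ∫ z, w (x₀ + δ • z) * nearDefect l δ ‖δ • z‖ := by
    rw [e2, abs_of_pos (by positivity)]
    simp only [finrank_euclideanSpace, Fintype.card_fin, Complex.real_smul]
    push_cast
    field_simp
  rw [e1, e3, ← integral_const_mul]
  congr 1
  ext z
  simp only [hH]
  have hz : ‖δ • z‖ = δ * ‖z‖ := by rw [norm_smul, Real.norm_of_nonneg hδ.le]
  have hdiv : δ * ‖z‖ / δ = ‖z‖ := by field_simp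
  rw [hz, nearDefect, hdiv, yukawa]
  by_cases h : ‖z‖ ≤ 1
  · simp [deriv_step_eq_zero.1 _ h, deriv_deriv_step_eq_zero.1 _ h]
  · have hz0 : (‖z‖ : ℂ) ≠ 0 := by exact_mod_cast (by linarith : 0 < ‖z‖).ne'
    rw [max_eq_left (not_le.1 h).le]
    push_cast
    field_simp

/-- Dominated convergence: the outer cutoff is `1` on the support of `f`, and the inner one tends to
`1` off `x₀`. -/
lemma tendsto_integral_testFun {f : E3 → ℝ} {R ρ : ℝ} (hf2 : MemLp f 2 volume)
    (hf : Function.support f ⊆ Metric.closedBall 0 R) (hρ : 0 < ρ) (hRρ : R ≤ ρ) (l : ℂ)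
    (x₀ : E3) :
    Tendsto (fun δ : ℝ => ∫ y, testFun l δ ρ x₀ y * f y) (𝓝[>] 0) (𝓝 (pot f x₀ l)) := by
  refine tendsto_integral_filter_of_dominated_convergence
    (fun y => ‖yukawa l ‖y - x₀‖ * f y‖) ?_ ?_ (integrable_yukawa_mul hf2 hf x₀ l).norm ?_
  · filter_upwards [self_mem_nhdsWithin] with δ hδ
    have h1 : AEMeasurable fun y => ((f y : ℝ) : ℂ) :=
      Complex.measurable_ofReal.comp_aemeasurable hf2.aestronglyMeasurable.aemeasurable
    exact ((contDiff_testFun hδ hρ).continuous.measurable.aemeasurable.mul h1).aestronglyMeasurable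
  · filter_upwards with δ
    refine Eventually.of_forall fun y => ?_
    rw [testFun, cutYukawa, norm_mul, norm_mul, norm_mul, norm_mul]
    have h1 := norm_one_sub_step_le_one (‖y‖ / ρ)
    have h2 := norm_step_le_one (‖y - x₀‖ / δ)
    calc _ ≤ 1 * (1 * ‖yukawa l ‖y - x₀‖‖) * ‖(f y : ℂ)‖ := by gcongr
      _ = _ := by ring
  · refine Eventually.of_forall fun y => ?_
    by_cases h0 : f y = 0
    · simp [h0]
    have hy : ‖y‖ ≤ ρ := by
      have : ‖y‖ ≤ R := by simpa using hf h0
      linarith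
    by_cases hx : y = x₀
    · simp [hx, testFun, cutYukawa, yukawa]
    have hN : 0 < ‖y - x₀‖ := norm_pos_iff.2 (sub_ne_zero.2 hx)
    refine tendsto_const_nhds.congr' ?_
    filter_upwards [Ioo_mem_nhdsGT (show 0 < ‖y - x₀‖ / 2 by positivity)] with δ hδ
    rw [testFun, cutYukawa, step_of_le_one ((div_le_one hρ).2 hy),
      step_of_two_le ((le_div_iff₀ hδ.1).2 (by linarith [hδ.2]))]
    ring

end Limits

/-! ### Polar coordinates. -/

section Polar

/-- The absolute value is taken only after integrating along each ray, so cancellation in the radial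
variable is kept. -/
lemma norm_integral_le_of_rays {g : E3 → ℂ} (hg : Integrable g) {M : ℝ}
    (hM : ∀ ν : E3, ‖ν‖ = 1 → ‖∫ r in Set.Ioi (0 : ℝ), (r : ℂ) ^ 2 * g (r • ν)‖ ≤ M) :
    ‖∫ x, g x‖ ≤ sphereArea * M := by
  set μ : Measure E3 := volume
  set φ := homeomorphUnitSphereProd E3
  have hmp := μ.measurePreserving_homeomorphUnitSphereProd
  have e1 : ∫ x, g x ∂μ = ∫ x : ({(0)}ᶜ : Set E3), g x ∂(μ.comap (↑)) := by
    rw [integral_subtype_comap (measurableSet_singleton _).compl g, restrict_compl_singleton]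
  have hfun : (fun x : ({(0)}ᶜ : Set E3) => g x) = (fun p => g (φ.symm p)) ∘ φ := by
    ext x; simp
  have e2 : ∫ x : ({(0)}ᶜ : Set E3), g x ∂(μ.comap (↑))
      = ∫ p, g (φ.symm p) ∂(μ.toSphere.prod (.volumeIoiPow (Module.finrank ℝ E3 - 1))) := by
    rw [← hmp.integral_comp (Homeomorph.measurableEmbedding _)]
    exact congrArg (fun h => ∫ x, h x ∂(μ.comap (↑))) hfun
  have hint : Integrable (fun p => g (φ.symm p))
      (μ.toSphere.prod (.volumeIoiPow (Module.finrank ℝ E3 - 1))) := by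
    rw [← hmp.integrable_comp_emb (Homeomorph.measurableEmbedding _), ← hfun]
    have : IntegrableOn g ({(0)}ᶜ : Set E3) μ := hg.integrableOn
    rwa [integrableOn_iff_comap_subtypeVal (by measurability)] at this
  rw [e1, e2, integral_prod _ hint]
  refine (norm_integral_le_of_norm_le_const (C := M) (Eventually.of_forall fun s => ?_)).trans ?_
  · refine le_trans (le_of_eq ?_) (hM s (by simp))
    congr 1
    simp only [Measure.volumeIoiPow, ENNReal.ofReal]
    rw [integral_withDensity_eq_integral_smul
      (by exact (measurable_subtype_coe.pow_const _).real_toNNReal)]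
    rw [← integral_subtype_comap measurableSet_Ioi fun r : ℝ => (r : ℂ) ^ 2 * g (r • (s : E3))]
    refine integral_congr_ae (Eventually.of_forall fun r => ?_)
    have hr : 0 < (r : ℝ) := r.2
    simp only [φ, homeomorphUnitSphereProd_symm_apply_coe, finrank_euclideanSpace, Fintype.card_fin]
    rw [NNReal.smul_def, Real.coe_toNNReal _ (by positivity), Complex.real_smul]
    push_cast
    rfl
  · rw [mul_comm]; rfl

end Polar

/-! ### Consequences of the radiation condition. -/

section Radiation

variable {κ : ℝ} {w : E3 → ℂ}

lemma eventually_cobounded_iff_norm {P : E3 → Prop} :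
    (∀ᶠ x in Bornology.cobounded E3, P x) ↔ ∃ r : ℝ, ∀ x, r ≤ ‖x‖ → P x := by
  rw [← comap_norm_atTop, eventually_comap, eventually_atTop]
  exact ⟨fun ⟨r, h⟩ => ⟨r, fun x hx => h _ hx x rfl⟩, fun ⟨r, h⟩ => ⟨r, fun b hb x hx =>
    h x (hx ▸ hb)⟩⟩

lemma RadiationCondition.eventually_le (h : RadiationCondition κ w) {η : ℝ} (hη : 0 < η) :
    ∃ r : ℝ, 1 ≤ r ∧ ∀ x : E3, r ≤ ‖x‖ → DifferentiableAt ℝ w x ∧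
      ‖fderiv ℝ w x (‖x‖⁻¹ • x) - Complex.I * κ * w x‖ ≤ η / ‖x‖ := by
  obtain ⟨r1, h1⟩ := eventually_cobounded_iff_norm.1 h.1
  obtain ⟨r2, h2⟩ := eventually_cobounded_iff_norm.1
    ((tendsto_zero_iff_norm_tendsto_zero.1 h.2).eventually (Iic_mem_nhds hη))
  refine ⟨max 1 (max r1 r2), le_max_left _ _, fun x hx => ?_⟩
  simp only [max_le_iff] at hx
  refine ⟨h1 x hx.2.1, ?_⟩
  have h3 : ‖_‖ ≤ η := h2 x hx.2.2
  rw [norm_mul, Complex.norm_real, norm_norm] at h3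
  rw [le_div_iff₀ (by linarith [hx.1]), mul_comm]
  exact h3

lemma hasDerivAt_ray {ν : E3} {r : ℝ} (hν : ‖ν‖ = 1) (hr : 0 < r)
    (hw : DifferentiableAt ℝ w (r • ν)) :
    HasDerivAt (fun t : ℝ => w (t • ν))
      (fderiv ℝ w (r • ν) (‖r • ν‖⁻¹ • (r • ν))) r := by
  have h1 : HasDerivAt (fun t : ℝ => t • ν) ν r := by
    simpa using (hasDerivAt_id r).smul_const ν
  refine (hw.hasFDerivAt.comp_hasDerivAt r h1).congr_deriv ?_
  rw [norm_smul, hν, Real.norm_of_nonneg hr.le, mul_one, smul_smul, inv_mul_cancel₀ hr.ne',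
    one_smul]

/-- Along a ray `e^{-iκr} w` has derivative `o(1/r)`, uniformly in the direction, and `w` is bounded
on a fixed sphere; integration gives `w = o(r)`. -/
lemma RadiationCondition.norm_le (h : RadiationCondition κ w) (hw : Continuous w) {η : ℝ}
    (hη : 0 < η) : ∃ r : ℝ, ∀ x : E3, r ≤ ‖x‖ → ‖w x‖ ≤ η * ‖x‖ := by
  obtain ⟨r1, hr1, h1⟩ := h.eventually_le (half_pos hη)
  obtain ⟨M, hM⟩ := (isCompact_closedBall (0 : E3) r1).exists_bound_of_continuousOn hw.continuousOn
  refine ⟨max r1 (2 * M / η), fun x hx => ?_⟩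
  have hx1 : r1 ≤ ‖x‖ := (le_max_left _ _).trans hx
  have hx2 : 2 * M / η ≤ ‖x‖ := (le_max_right _ _).trans hx
  have hx0 : 0 < ‖x‖ := by linarith
  set ν : E3 := ‖x‖⁻¹ • x with hν
  have hν1 : ‖ν‖ = 1 := by
    rw [hν, norm_smul, norm_inv, norm_norm, inv_mul_cancel₀ hx0.ne']
  have hxν : ‖x‖ • ν = x := by rw [hν, smul_smul, mul_inv_cancel₀ hx0.ne', one_smul]
  have hnorm : ∀ r : ℝ, 0 ≤ r → ‖r • ν‖ = r := fun r hr => by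
    rw [norm_smul, hν1, Real.norm_of_nonneg hr, mul_one]
  have hexp : ∀ r : ℝ, ‖Complex.exp (-(Complex.I * κ * r))‖ = 1 := fun r => by
    have : (-(Complex.I * κ * r) : ℂ) = ((-(κ * r) : ℝ) : ℂ) * Complex.I := by push_cast; ring
    rw [this, Complex.norm_exp_ofReal_mul_I]
  set g : ℝ → ℂ := fun r => Complex.exp (-(Complex.I * κ * r)) * w (r • ν) with hg
  have hder : ∀ r ∈ Set.Icc r1 ‖x‖, HasDerivAt g (Complex.exp (-(Complex.I * κ * r)) *
      (fderiv ℝ w (r • ν) (‖r • ν‖⁻¹ • (r • ν)) - Complex.I * κ * w (r • ν))) r := by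
    intro r hr
    have hr0 : 0 < r := by linarith [hr.1]
    have hof : HasDerivAt (fun r : ℝ => (r : ℂ)) 1 r := Complex.ofRealCLM.hasDerivAt
    have := ((hof.const_mul (Complex.I * κ)).neg.cexp).mul
      (hasDerivAt_ray hν1 hr0 (h1 _ (by rw [hnorm r hr0.le]; exact hr.1)).1)
    refine this.congr_deriv ?_
    simp only [Pi.neg_apply]
    ring
  have hmv := norm_image_sub_le_of_norm_deriv_right_le_segment (f := g) (a := r1) (b := ‖x‖)
    (C := η / 2) (fun r hr => (hder r hr).continuousAt.continuousWithinAt)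
    (fun r hr => (hder r (Set.Ico_subset_Icc_self hr)).hasDerivWithinAt)
    (fun r hr => ?_) ‖x‖ ⟨hx1, le_rfl⟩
  · have e1 : ‖g ‖x‖‖ = ‖w x‖ := by rw [hg]; simp only [norm_mul, hexp, one_mul, hxν]
    have e2 : ‖g r1‖ ≤ M := by
      rw [hg]; simp only [norm_mul, hexp, one_mul]
      exact hM _ (by simp [hnorm r1 (by linarith)])
    have e3 := norm_sub_norm_le (g ‖x‖) (g r1)
    rw [e1] at e3
    rw [div_le_iff₀ hη] at hx2
    nlinarith
  · have hr0 : 0 < r := by linarith [hr.1]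
    rw [norm_mul, hexp, one_mul]
    refine (h1 _ (by rw [hnorm r hr0.le]; exact hr.1)).2.trans ?_
    rw [hnorm r hr0.le]
    exact div_le_self (by positivity) (hr1.trans hr.1)

end Radiation

/-! ### Outgoing solutions are potentials. -/

section Representation

variable {κ R : ℝ} {l : ℂ} {w : E3 → ℂ} {f : E3 → ℝ}

lemma continuous_nearDefect {δ : ℝ} (hδ : 0 < δ) (l : ℂ) (x₀ : E3) :
    Continuous fun y : E3 => nearDefect l δ ‖y - x₀‖ := by
  have h := contDiff_cutYukawa (l := l) (x₀ := x₀) hδ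
  have : (fun y : E3 => nearDefect l δ ‖y - x₀‖) = fun y =>
      Δ (fun y : E3 => cutYukawa l δ ‖y - x₀‖) y - l ^ 2 * cutYukawa l δ ‖y - x₀‖ :=
    funext fun y => (laplacian_cutYukawa hδ y).symm
  rw [this]
  exact (contDiff_laplacian h).continuous.sub (continuous_const.mul h.continuous)

lemma integrable_mul_nearDefect (hw : Continuous w) {δ : ℝ} (hδ : 0 < δ) (l : ℂ) (x₀ : E3) :
    Integrable fun y : E3 => w y * nearDefect l δ ‖y - x₀‖ := by
  refine (hw.mul (continuous_nearDefect hδ l x₀)).integrable_of_hasCompactSupport ?_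
  refine HasCompactSupport.intro (isCompact_closedBall x₀ (2 * δ)) fun y hy => ?_
  have h1 : 2 * δ < ‖y - x₀‖ := by simpa [dist_eq_norm] using hy
  have h2 : 2 ≤ ‖y - x₀‖ / δ := (le_div_iff₀ hδ).2 h1.le
  simp [nearDefect, deriv_step_eq_zero.2 _ h2, deriv_deriv_step_eq_zero.2 _ h2]

lemma integrable_mul_testFun (hw : Continuous w) {δ ρ : ℝ} (hδ : 0 < δ) (hρ : 0 < ρ) (l : ℂ)
    (x₀ : E3) : Integrable fun y =>
      w y * (Δ (testFun l δ ρ x₀) y - l ^ 2 * testFun l δ ρ x₀ y) := by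
  have h1 := contDiff_testFun (l := l) (x₀ := x₀) hδ hρ
  have h2 := hasCompactSupport_testFun (l := l) (δ := δ) (x₀ := x₀) hρ
  refine (hw.mul ((contDiff_laplacian h1).continuous.sub
    (continuous_const.mul h1.continuous))).integrable_of_hasCompactSupport ?_
  have h3 : HasCompactSupport fun y => l ^ 2 * testFun l δ ρ x₀ y := h2.mul_left
  exact (h2.laplacian.sub h3).mul_left

lemma integrable_mul_farDefect (hw : Continuous w) (l : ℂ) {ρ : ℝ} {x₀ : E3}
    (hρ : ‖x₀‖ < ρ) : Integrable fun y => w y * farDefect l ρ x₀ y := by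
  -- Any admissible `δ` would do: the outer defect is the full defect minus the inner one, and both
  -- of these are continuous with compact support.
  set δ := (ρ - ‖x₀‖) / 4 with hδ
  have hδ0 : 0 < δ := by rw [hδ]; linarith
  have hρ0 : 0 < ρ := (norm_nonneg _).trans_lt hρ
  refine ((integrable_mul_testFun hw hδ0 hρ0 l x₀).sub
    (integrable_mul_nearDefect hw hδ0 l x₀)).congr (Eventually.of_forall fun y => ?_)
  simp only [Pi.sub_apply]
  rw [laplacian_testFun hδ0 (by rw [hδ]; linarith)]
  ring

/-- The left side does not involve `δ`, so the tested equation can be passed to the limit `δ → 0`.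
-/
lemma integral_farDefect_eq (hw : Continuous w) (hf2 : MemLp f 2 volume)
    (hf : Function.support f ⊆ Metric.closedBall 0 R)
    (hweak : ∀ ψ : E3 → ℂ, ContDiff ℝ ∞ ψ → HasCompactSupport ψ →
      ∫ x, w x * (Δ ψ x - l ^ 2 * ψ x) = ∫ x, ψ x * f x) {ρ : ℝ} {x₀ : E3}
    (hρ : ‖x₀‖ < ρ) (hRρ : R ≤ ρ) :
    ∫ y, w y * farDefect l ρ x₀ y = pot f x₀ l + w x₀ := by
  have hρ0 : 0 < ρ := (norm_nonneg _).trans_lt hρ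
  have h1 := (tendsto_integral_testFun hf2 hf hρ0 hRρ l x₀).sub
    (tendsto_integral_nearDefect hw l x₀)
  rw [sub_neg_eq_add] at h1
  refine tendsto_nhds_unique (tendsto_const_nhds.congr' ?_) h1
  have hpos : 0 < (ρ - ‖x₀‖) / 4 := by linarith
  filter_upwards [Ioo_mem_nhdsGT hpos] with δ hδ
  rw [← hweak _ (contDiff_testFun hδ.1 hρ0) (hasCompactSupport_testFun hρ0),
    ← integral_sub (integrable_mul_testFun hw hδ.1 hρ0 l x₀)
      (integrable_mul_nearDefect hw hδ.1 l x₀)]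
  congr 1
  ext y
  rw [laplacian_testFun hδ.1 (by linarith [hδ.2])]
  ring

/-- `B` is chosen before `η` and `ρ`, so the outer defect contributes nothing as `ρ → ∞`. The phase
`κ` of `w` is independent of `l`, because `Δu + κ²u` is known only to satisfy the condition with `κ`
while its kernel has `l = -κ`. -/
lemma exists_norm_integral_farDefect_le (hw : Continuous w) (hrad : RadiationCondition κ w)
    (hl0 : l.re ≤ 0) (hl : l = Complex.I * κ ∨ l.re < 0) (hμ : l + Complex.I * κ ≠ 0) (x₀ : E3) :
    ∃ B : ℝ, 0 ≤ B ∧ ∀ η : ℝ, 0 < η → ∃ ρ₀ : ℝ, ∀ ρ : ℝ, ρ₀ ≤ ρ →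
      ‖∫ y, w y * farDefect l ρ x₀ y‖ ≤ B * η := by
  obtain ⟨c, hc0, hc⟩ := exists_ray_yukawa_bounds x₀ hl0 hl
  obtain ⟨K, hK0, hK⟩ := exists_bound_deriv_step
  have ha := norm_nonneg x₀
  refine ⟨sphereArea * ((3 + 4 / ‖l + Complex.I * κ‖) * (K * c)),
    mul_nonneg measureReal_nonneg (by positivity), fun η hη => ?_⟩
  obtain ⟨r1, hr1, h1⟩ := hrad.eventually_le hη
  obtain ⟨r2, h2⟩ := hrad.norm_le hw hη
  refine ⟨max (max r1 r2) (2 * ‖x₀‖ + 1) + 1, fun ρ hρ => ?_⟩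
  set r₀ := max (max r1 r2) (2 * ‖x₀‖ + 1) with hr₀
  have k1 : r1 ≤ r₀ := (le_max_left _ _).trans (le_max_left _ _)
  have k2 : r2 ≤ r₀ := (le_max_right _ _).trans (le_max_left _ _)
  have k3 : 2 * ‖x₀‖ + 1 ≤ r₀ := le_max_right _ _
  have hρ0 : 0 < ρ := by linarith
  rw [mul_assoc]
  refine norm_integral_le_of_rays (integrable_mul_farDefect hw l (by linarith)) fun ν hν => ?_
  have hnorm : ∀ r : ℝ, 0 ≤ r → ‖r • ν‖ = r := fun r hr => by
    rw [norm_smul, hν, Real.norm_of_nonneg hr, mul_one]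
  set I : ℝ → ℂ := fun r => (r : ℂ) ^ 2 * (w (r • ν) * ((cutDeriv2 ρ r + 2 / r * cutDeriv ρ r)
    * yukawa l ‖r • ν - x₀‖ + 2 * (cutDeriv ρ r *
      (rayDistDeriv x₀ ν r * yukawaDeriv l ‖r • ν - x₀‖)))) with hI
  have e1 : ∫ r in Set.Ioi (0 : ℝ), (r : ℂ) ^ 2 * (w (r • ν) * farDefect l ρ x₀ (r • ν))
      = ∫ r in Set.Ioi (0 : ℝ), I r := by
    refine setIntegral_congr_fun measurableSet_Ioi fun r hr => ?_
    have hr : 0 < r := hr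
    simp only [hI, farDefect, hnorm r hr.le, rayDistDeriv]
    rw [smul_smul, inv_mul_cancel₀ hr.ne', one_smul]
  have e2 : ∫ r in Set.Ioi (0 : ℝ), I r = ∫ r in ρ..2 * ρ, I r := by
    rw [intervalIntegral.integral_of_le (by linarith)]
    refine setIntegral_eq_of_subset_of_forall_sdiff_eq_zero measurableSet_Ioi
      (fun r hr => hρ0.trans hr.1) fun r hr => ?_
    have hz : deriv step (r / ρ) = 0 ∧ deriv (deriv step) (r / ρ) = 0 := by
      by_cases h : r ≤ ρ
      · have := (div_le_one hρ0).2 h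
        exact ⟨deriv_step_eq_zero.1 _ this, deriv_deriv_step_eq_zero.1 _ this⟩
      · have h' : 2 * ρ ≤ r := by
          by_contra h'
          exact hr.2 ⟨not_le.1 h, (not_le.1 h').le⟩
        have := (le_div_iff₀ hρ0).2 h'
        exact ⟨deriv_step_eq_zero.2 _ this, deriv_deriv_step_eq_zero.2 _ this⟩
    simp [hI, cutDeriv, cutDeriv2, hz.1, hz.2]
  have hρn : ‖((ρ : ℂ)⁻¹)‖ = ρ⁻¹ := by
    rw [norm_inv, Complex.norm_real, Real.norm_of_nonneg hρ0.le]
  rw [e1, e2]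
  refine (norm_radial_tail_le (κ := κ) (r₀ := r₀) (c := c) (η := η) (K := K) (l := l)
    (W := fun r => w (r • ν)) (W' := fun r => fderiv ℝ w (r • ν) (‖r • ν‖⁻¹ • (r • ν)))
    (Φ := fun r => yukawa l ‖r • ν - x₀‖)
    (Φ' := fun r => rayDistDeriv x₀ ν r * yukawaDeriv l ‖r • ν - x₀‖)
    (s := cutDeriv ρ) (s' := cutDeriv2 ρ) hμ (by linarith) (by linarith) hK0 hc0 hη.le
    ?_ ?_ ?_ ?_ ?_ ?_ ?_ ?_ ?_ ?_ ?_ ?_ ?_ ?_).trans (le_of_eq (by ring))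
  · intro r hr
    have hr : r₀ < r := hr
    exact hasDerivAt_ray hν (by linarith) (h1 _ (by rw [hnorm r (by linarith)]; linarith)).1
  · intro r hr
    have hr : r₀ < r := hr
    have hN : ‖r • ν - x₀‖ ≠ 0 :=
      norm_ne_zero_iff.2 (sub_ne_zero.2 (ray_ne hν (by linarith)))
    refine ((hasDerivAt_yukawa l hN).scomp r (hasDerivAt_ray_dist hν (by linarith))).congr_deriv ?_
    rw [Complex.real_smul]
  · exact fun r _ => hasDerivAt_cutDeriv r
  · have hmaps : Set.MapsTo (fun r : ℝ => ‖r • ν - x₀‖) (Set.Ioi r₀) {0}ᶜ := fun r hr => by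
      have hr : r₀ < r := hr
      exact norm_ne_zero_iff.2 (sub_ne_zero.2 (ray_ne hν (by linarith)))
    refine (Complex.continuous_ofReal.comp_continuousOn
      ((continuousOn_rayDistDeriv hν).mono (Set.Ioi_subset_Ioi k3))).mul ?_
    exact (continuousOn_yukawaDeriv l).comp (by fun_prop) hmaps
  · have h := continuous_deriv_deriv_step
    unfold cutDeriv2
    fun_prop
  · intro r hr
    have hr0 : 0 ≤ r := by linarith [hr.1]
    have := (h1 (r • ν) (by rw [hnorm r hr0]; linarith [hr.1])).2
    rwa [hnorm r hr0] at this ⊢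
  · intro r hr
    have hr0 : 0 ≤ r := by linarith [hr.1]
    have := h2 (r • ν) (by rw [hnorm r hr0]; linarith [hr.1])
    rwa [hnorm r hr0] at this
  · exact fun r hr => (hc ν hν r (by linarith [hr.1])).1
  · exact fun r hr => (hc ν hν r (by linarith [hr.1])).2.1
  · exact fun r hr => (hc ν hν r (by linarith [hr.1])).2.2
  · intro r _
    rw [cutDeriv, norm_neg, norm_mul, hρn, show K / ρ = ρ⁻¹ * K from div_eq_inv_mul _ _]
    gcongr
    exact (hK _).1
  · intro r _
    rw [cutDeriv2, norm_neg, norm_mul, norm_mul, hρn]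
    have : K / ρ ^ 2 = ρ⁻¹ * (ρ⁻¹ * K) := by field_simp
    rw [this]
    gcongr
    exact (hK _).2
  · simp [cutDeriv, div_self hρ0.ne', deriv_step_eq_zero.1 1 le_rfl]
  · simp [cutDeriv, mul_div_assoc, div_self hρ0.ne', deriv_step_eq_zero.2 2 le_rfl]

/-- An outgoing weak solution of `Δ w - l² w = f` is the potential of its source. -/
theorem eq_neg_pot (hw : Continuous w) (hrad : RadiationCondition κ w)
    (hl0 : l.re ≤ 0) (hl : l = Complex.I * κ ∨ l.re < 0) (hμ : l + Complex.I * κ ≠ 0)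
    (hf2 : MemLp f 2 volume) (hf : Function.support f ⊆ Metric.closedBall 0 R)
    (hweak : ∀ ψ : E3 → ℂ, ContDiff ℝ ∞ ψ → HasCompactSupport ψ →
      ∫ x, w x * (Δ ψ x - l ^ 2 * ψ x) = ∫ x, ψ x * f x) (x₀ : E3) :
    w x₀ = -pot f x₀ l := by
  obtain ⟨B, hB0, hB⟩ := exists_norm_integral_farDefect_le hw hrad hl0 hl hμ x₀
  have key : ∀ η : ℝ, 0 < η → ‖pot f x₀ l + w x₀‖ ≤ B * η := by
    intro η hη
    obtain ⟨ρ₀, hρ₀⟩ := hB η hη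
    set ρ := max ρ₀ (max R (‖x₀‖ + 1)) with hρ
    have h1 : ‖x₀‖ < ρ := by
      have : ‖x₀‖ + 1 ≤ ρ := (le_max_right _ _).trans (le_max_right _ _)
      linarith
    have h2 := hρ₀ ρ (le_max_left _ _)
    rwa [integral_farDefect_eq hw hf2 hf hweak h1
      ((le_max_left _ _).trans (le_max_right _ _))] at h2
  have h0 : ‖pot f x₀ l + w x₀‖ ≤ 0 := by
    refine le_of_forall_pos_le_add fun η hη => ?_
    have := key (η / (B + 1)) (by positivity)
    refine this.trans ?_
    rw [zero_add, mul_div_assoc', div_le_iff₀ (by positivity)]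
    nlinarith
  rw [norm_le_zero_iff] at h0
  linear_combination h0

end Representation

/-! ### Factorization of the biharmonic equation. -/

section Splitting

variable {κ : ℝ} {f : E3 → ℝ} {u : E3 → ℂ}

lemma RadiationCondition.add_const_mul {v w : E3 → ℂ} (hv : RadiationCondition κ v)
    (hw : RadiationCondition κ w) (c : ℂ) : RadiationCondition κ fun x => v x + c * w x := by
  refine ⟨?_, ?_⟩
  · filter_upwards [hv.1, hw.1] with x h1 h2
    exact h1.add (h2.const_mul c)
  · have h := hv.2.add (hw.2.const_mul c)
    rw [mul_zero, add_zero] at h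
    refine h.congr' ?_
    filter_upwards [hv.1, hw.1] with x h1 h2
    rw [fderiv_fun_add h1 (h2.const_mul c), fderiv_const_mul h2]
    simp
    ring

lemma integrable_mul_ofReal {g : E3 → ℝ} (hf2 : MemLp f 2 volume) (hg : Continuous g)
    (hc : HasCompactSupport g) : Integrable fun x => f x * g x :=
  hf2.integrable_mul (hg.memLp_of_hasCompactSupport (p := 2) hc)

/-- The equation is given for real test functions; the truncated kernel is complex, so real and
imaginary parts are tested separately. -/
lemma IsScatteringSolution.equation_complex (h : IsScatteringSolution f κ u)
    (hf2 : MemLp f 2 volume) {ψ : E3 → ℂ} (hψ : ContDiff ℝ ∞ ψ) (hc : HasCompactSupport ψ) :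
    ∫ x, u x * (Δ (Δ ψ) x - κ ^ 4 * ψ x) = ∫ x, ψ x * f x := by
  have hu := h.contDiff.continuous
  have part : ∀ L : ℂ →L[ℝ] ℝ,
      Integrable (fun x => u x * ((L (Δ (Δ ψ) x - κ ^ 4 * ψ x) : ℝ) : ℂ)) ∧
      Integrable (fun x => ((f x * L (ψ x) : ℝ) : ℂ)) ∧
      ∫ x, u x * ((L (Δ (Δ ψ) x - κ ^ 4 * ψ x) : ℝ) : ℂ) = ∫ x, ((f x * L (ψ x) : ℝ) : ℂ) := by
    intro L
    have hφ : ContDiff ℝ ∞ (fun x => L (ψ x)) := L.contDiff.comp hψ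
    have hφc : HasCompactSupport (fun x => L (ψ x)) := hc.comp_left L.map_zero
    have hlap : ∀ {g : E3 → ℂ}, ContDiff ℝ ∞ g → Δ (fun x => L (g x)) = fun x => L (Δ g x) :=
      fun hg => funext fun x => ContDiffAt.laplacian_CLM_comp_left (l := L)
        (hg.contDiffAt.of_le (by norm_cast))
    have e : ∀ x, L (Δ (Δ ψ) x - κ ^ 4 * ψ x)
        = Δ (Δ (fun x => L (ψ x))) x - κ ^ 4 * L (ψ x) := fun x => by
      rw [hlap hψ, hlap (contDiff_laplacian hψ), map_sub]
      have : (κ ^ 4 * ψ x : ℂ) = (κ ^ 4 : ℝ) • ψ x := by simp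
      rw [this, map_smul, smul_eq_mul]
    refine ⟨?_, (integrable_mul_ofReal hf2 hφ.continuous hφc).ofReal, ?_⟩
    · have c1 : Continuous fun x => ((L (Δ (Δ ψ) x - κ ^ 4 * ψ x) : ℝ) : ℂ) := by
        have := (contDiff_laplacian (contDiff_laplacian hψ)).continuous
        have := hψ.continuous
        fun_prop
      refine (hu.mul c1).integrable_of_hasCompactSupport (HasCompactSupport.mul_left ?_)
      have c2 : HasCompactSupport fun x => Δ (Δ ψ) x - κ ^ 4 * ψ x :=
        hc.laplacian.laplacian.sub hc.mul_left
      exact c2.comp_left (g := fun z => ((L z : ℝ) : ℂ)) (by simp)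
    · simp only [e]
      rw [h.equation _ hφ hφc]
      exact integral_ofReal.symm
  obtain ⟨a1, a2, a3⟩ := part Complex.reCLM
  obtain ⟨b1, b2, b3⟩ := part Complex.imCLM
  have hsplit : ∀ z : ℂ, z = ((Complex.reCLM z : ℝ) : ℂ) + Complex.I * ((Complex.imCLM z : ℝ) : ℂ) :=
    fun z => by rw [mul_comm]; exact (Complex.re_add_im z).symm
  have e1 : (fun x => u x * (Δ (Δ ψ) x - κ ^ 4 * ψ x)) = fun x =>
      u x * ((Complex.reCLM (Δ (Δ ψ) x - κ ^ 4 * ψ x) : ℝ) : ℂ)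
      + Complex.I * (u x * ((Complex.imCLM (Δ (Δ ψ) x - κ ^ 4 * ψ x) : ℝ) : ℂ)) := by
    ext x
    conv_lhs => rw [hsplit (Δ (Δ ψ) x - κ ^ 4 * ψ x)]
    ring
  have e2 : (fun x => ψ x * f x) = fun x => ((f x * Complex.reCLM (ψ x) : ℝ) : ℂ)
      + Complex.I * ((f x * Complex.imCLM (ψ x) : ℝ) : ℂ) := by
    ext x
    conv_lhs => rw [hsplit (ψ x)]
    push_cast
    ring
  rw [e1, e2, integral_add a1 (b1.const_mul _), integral_add a2 (b2.const_mul _),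
    integral_const_mul, integral_const_mul, a3, b3]

/-- Only the factor `Δ + c` of `(Δ + c)(Δ - c)` is moved onto `u`, which is possible because `u` is
`C²`. -/
lemma IsScatteringSolution.weak_factor (h : IsScatteringSolution f κ u)
    (hf2 : MemLp f 2 volume) {c : ℂ} (hcκ : c ^ 2 = κ ^ 4) {ψ : E3 → ℂ} (hψ : ContDiff ℝ ∞ ψ)
    (hc : HasCompactSupport ψ) :
    ∫ x, (Δ u x + c * u x) * (Δ ψ x - c * ψ x) = ∫ x, ψ x * f x := by
  rw [← h.equation_complex hf2 hψ hc]
  have hu := h.contDiff.continuous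
  have hΔu := continuous_laplacian h.contDiff
  have hΔψ := contDiff_laplacian hψ
  have hΔc := hc.laplacian
  have le2 : (2 : ℕ∞ω) ≤ ∞ := by norm_cast
  have int1 : ∀ {a b : E3 → ℂ}, Continuous a → Continuous b → HasCompactSupport b →
      Integrable (fun x => a x * b x) := fun ha hb hbc =>
    (ha.mul hb).integrable_of_hasCompactSupport hbc.mul_left
  have i1 := int1 hΔu hΔψ.continuous hΔc
  have i2 := (int1 hΔu hψ.continuous hc).const_mul c
  have i3 := (int1 hu hΔψ.continuous hΔc).const_mul c
  have i4 := (int1 hu hψ.continuous hc).const_mul (κ ^ 4 : ℂ)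
  have i5 := int1 hu (contDiff_laplacian hΔψ).continuous hΔc.laplacian
  have e1 : (fun x => (Δ u x + c * u x) * (Δ ψ x - c * ψ x)) = fun x =>
      (Δ u x * Δ ψ x - c * (Δ u x * ψ x)) + (c * (u x * Δ ψ x) - κ ^ 4 * (u x * ψ x)) := by
    ext x; rw [← hcκ]; ring
  have e2 : (fun x => u x * (Δ (Δ ψ) x - κ ^ 4 * ψ x)) = fun x =>
      u x * Δ (Δ ψ) x - κ ^ 4 * (u x * ψ x) := by
    ext x; ring
  have i12 : Integrable fun x => Δ u x * Δ ψ x - c * (Δ u x * ψ x) := i1.sub i2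
  have i34 : Integrable fun x => c * (u x * Δ ψ x) - κ ^ 4 * (u x * ψ x) := i3.sub i4
  rw [e1, e2, integral_add i12 i34, integral_sub i1 i2, integral_sub i3 i4,
    integral_sub i5 i4, integral_const_mul, integral_const_mul, integral_const_mul,
    integral_mul_laplacian h.contDiff (hΔψ.of_le le2) hΔc,
    integral_mul_laplacian h.contDiff (hψ.of_le le2) hc]
  ring

lemma IsScatteringSolution.eq_neg_pot {R : ℝ} {l : ℂ} (h : IsScatteringSolution f κ u)
    (hf2 : MemLp f 2 volume) (hf : Function.support f ⊆ Metric.closedBall 0 R)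
    (hl0 : l.re ≤ 0) (hl : l = Complex.I * κ ∨ l.re < 0) (hμ : l + Complex.I * κ ≠ 0)
    (hl4 : l ^ 4 = κ ^ 4) (x : E3) : Δ u x + l ^ 2 * u x = -pot f x l :=
  _root_.eq_neg_pot (w := fun x => Δ u x + l ^ 2 * u x)
    ((continuous_laplacian h.contDiff).add (continuous_const.mul h.contDiff.continuous))
    (h.radiation_laplacian.add_const_mul h.radiation _) hl0 hl hμ hf2 hf
    (fun _ hψ hc => h.weak_factor hf2 (by rw [← hl4]; ring) hψ hc) x

/-- The two Helmholtz components of a scattering solution as potentials. -/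
lemma IsScatteringSolution.representation {R : ℝ} (h : IsScatteringSolution f κ u) (hκ : 0 < κ)
    (hf2 : MemLp f 2 volume) (hf : Function.support f ⊆ Metric.closedBall 0 R) (x : E3) :
    κ ^ 2 * u x = (pot f x (Complex.I * κ) - pot f x (-κ)) / 2 ∧
      Δ u x = -((pot f x (-κ) + pot f x (Complex.I * κ)) / 2) := by
  have hκC : (κ : ℂ) ≠ 0 := by exact_mod_cast hκ.ne'
  have h1 := h.eq_neg_pot (l := Complex.I * κ) hf2 hf (by simp) (Or.inl rfl)
    (by simp [← two_mul, hκ.ne']) (by rw [mul_pow, Complex.I_pow_four, one_mul]) x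
  have h2 := h.eq_neg_pot (l := -κ) hf2 hf (by simpa using hκ.le) (Or.inr (by simpa using hκ))
    (fun h0 => by
      have := congrArg Complex.re h0
      simp at this
      exact hκ.ne' this) (by ring) x
  rw [mul_pow, Complex.I_sq] at h1
  constructor
  · linear_combination (h2 - h1) / 2
  · linear_combination (h2 + h1) / 2

end Splitting

/-! ### Analytic continuation of the boundary data and its growth in the sector. -/

section BoundaryData

variable {f : E3 → ℝ} {R Q : ℝ}

/-- The integrand of the analytic continuation of the boundary data. -/
noncomputable def boundaryDensity (f : E3 → ℝ) (k : ℂ) (x : E3) : ℂ :=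
  (pot f x (Complex.I * k) - pot f x (-k)) * (pot f x (-(Complex.I * k)) - pot f x (-k))
    + k ^ 2 * ((pot f x (-k) + pot f x (Complex.I * k))
      * (pot f x (-k) + pot f x (-(Complex.I * k))))

/-- The analytic continuation of the boundary data to complex wavenumbers. -/
noncomputable def boundaryExt (R : ℝ) (f : E3 → ℝ) (k : ℂ) : ℂ :=
  R ^ 2 / 4 * ∫ s : Metric.sphere (0 : E3) 1, boundaryDensity f k (R • (s : E3))
    ∂(volume : Measure E3).toSphere

lemma norm_sq_eq_mul_conj (z : ℂ) : ((‖z‖ ^ 2 : ℝ) : ℂ) = z * (starRingEnd ℂ) z := by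
  rw [Complex.mul_conj, Complex.normSq_eq_norm_sq]

lemma boundaryExt_eq {u : ℝ → E3 → ℂ} {κ : ℝ} (hκ : 0 < κ) (hf2 : MemLp f 2 volume)
    (hf : Function.support f ⊆ Metric.closedBall 0 R) (h : IsScatteringSolution f κ (u κ)) :
    boundaryExt R f κ = (boundaryData R u κ : ℂ) := by
  have hc1 : Continuous fun s : Metric.sphere (0 : E3) 1 => ‖u κ (R • (s : E3))‖ ^ 2 := by
    have := h.contDiff.continuous
    fun_prop
  have hc2 : Continuous fun s : Metric.sphere (0 : E3) 1 => ‖Δ (u κ) (R • (s : E3))‖ ^ 2 := by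
    have := continuous_laplacian h.contDiff
    fun_prop
  have i1 : Integrable (fun s : Metric.sphere (0 : E3) 1 => ‖u κ (R • (s : E3))‖ ^ 2)
      (volume : Measure E3).toSphere :=
    hc1.integrable_of_hasCompactSupport (HasCompactSupport.of_compactSpace _)
  have i2 : Integrable (fun s : Metric.sphere (0 : E3) 1 => ‖Δ (u κ) (R • (s : E3))‖ ^ 2)
      (volume : Measure E3).toSphere :=
    hc2.integrable_of_hasCompactSupport (HasCompactSupport.of_compactSpace _)
  have e1 : boundaryData R u κ = R ^ 2 / 4 * ∫ s : Metric.sphere (0 : E3) 1,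
      (4 * κ ^ 4 * ‖u κ (R • (s : E3))‖ ^ 2 + 4 * κ ^ 2 * ‖Δ (u κ) (R • (s : E3))‖ ^ 2)
      ∂(volume : Measure E3).toSphere := by
    rw [boundaryData, sphereNormSq, sphereNormSq, integral_add (i1.const_mul _) (i2.const_mul _),
      integral_const_mul, integral_const_mul]
    ring
  rw [e1, boundaryExt]
  push_cast
  congr 1
  refine (integral_congr_ae (Eventually.of_forall fun s => ?_)).trans integral_ofReal
  obtain ⟨h1, h2⟩ := h.representation hκ hf2 hf (R • (s : E3))
  set x := R • (s : E3)
  have n1 : (((4 * κ ^ 4 * ‖u κ x‖ ^ 2 + 4 * κ ^ 2 * ‖Δ (u κ) x‖ ^ 2 : ℝ)) : ℂ)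
      = 4 * ((‖κ ^ 2 * u κ x‖ ^ 2 : ℝ) : ℂ) + 4 * κ ^ 2 * ((‖Δ (u κ) x‖ ^ 2 : ℝ) : ℂ) := by
    rw [norm_mul, norm_pow, Complex.norm_real, Real.norm_of_nonneg hκ.le]
    push_cast
    ring
  -- For real `κ`, conjugation exchanges `iκ` and `-iκ` and fixes `-κ`, which turns the squared
  -- moduli into the analytic products of `boundaryDensity`.
  have k1 : (starRingEnd ℂ) (pot f x (Complex.I * κ)) = pot f x (-(Complex.I * κ)) := by
    rw [conj_pot]; simp
  have k2 : (starRingEnd ℂ) (pot f x (-κ)) = pot f x (-κ) := by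
    rw [conj_pot]; simp
  simp only [RCLike.ofReal_eq_complex_ofReal]
  rw [n1, norm_sq_eq_mul_conj, norm_sq_eq_mul_conj, h1, h2]
  simp only [map_neg, map_div₀, map_sub, map_add, map_ofNat, k1, k2, boundaryDensity]
  ring

/-- The constant in the pointwise bound of the potentials on the sphere of radius `R`. -/
noncomputable def potConst (R : ℝ) : ℝ := 2⁻¹ * (sphereArea * (R + R) + 1)

lemma potConst_nonneg (hR : 0 ≤ R) : 0 ≤ potConst R := by
  have : 0 ≤ sphereArea := measureReal_nonneg
  unfold potConst
  positivity

lemma norm_boundaryDensity_le (hf2 : MemLp f 2 volume)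
    (hf : Function.support f ⊆ Metric.closedBall 0 R) (hR : 0 ≤ R) (hQ : 0 < Q)
    (hfQ : ∫ y, f y ^ 2 ≤ Q ^ 2) {x : E3} (hx : ‖x‖ ≤ R) {k : ℂ} {a : ℝ} (ha : 0 ≤ a)
    (h1 : |k.im| ≤ a) (h2 : -k.re ≤ a) :
    ‖boundaryDensity f k x‖ ≤
      4 * (potConst R * Q * Real.exp (a * (R + R))) ^ 2 * (1 + ‖k‖ ^ 2) := by
  set m := potConst R * Q * Real.exp (a * (R + R)) with hm
  have hm0 : 0 ≤ m := by have := potConst_nonneg hR; positivity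
  have b : ∀ l : ℂ, l.re ≤ a → ‖pot f x l‖ ≤ m := fun l hl =>
    norm_pot_le hf2 hf hR hx hQ hfQ ha hl
  have b1 := b (Complex.I * k) (by simpa using (neg_le_abs _).trans h1)
  have b2 := b (-(Complex.I * k)) (by simpa using (le_abs_self _).trans h1)
  have b3 := b (-k) (by simpa using h2)
  rw [boundaryDensity]
  calc _ ≤ (‖pot f x (Complex.I * k)‖ + ‖pot f x (-k)‖)
        * (‖pot f x (-(Complex.I * k))‖ + ‖pot f x (-k)‖)
      + ‖k‖ ^ 2 * ((‖pot f x (-k)‖ + ‖pot f x (Complex.I * k)‖)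
        * (‖pot f x (-k)‖ + ‖pot f x (-(Complex.I * k))‖)) := by
        refine (norm_add_le _ _).trans ?_
        rw [norm_mul, norm_mul, norm_mul, norm_pow]
        gcongr
        exacts [norm_sub_le _ _, norm_sub_le _ _, norm_add_le _ _, norm_add_le _ _]
    _ ≤ (m + m) * (m + m) + ‖k‖ ^ 2 * ((m + m) * (m + m)) := by gcongr
    _ = _ := by ring

/-- In the sector `±ik` and `-k` have real part at most `Re k`, and distances in the ball are at
most `2R`; a product of two potentials gives `e^{4R Re k}`. -/
lemma norm_boundaryExt_le (hf2 : MemLp f 2 volume)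
    (hf : Function.support f ⊆ Metric.closedBall 0 R) (hR : 0 ≤ R) (hQ : 0 < Q)
    (hfQ : ∫ y, f y ^ 2 ≤ Q ^ 2) {k : ℂ} (hk : |k.im| ≤ k.re) :
    ‖boundaryExt R f k‖ ≤ R ^ 2 * sphereArea * (potConst R * Q) ^ 2
      * (Real.exp (4 * R * k.re) * (1 + 2 * k.re ^ 2)) := by
  have ha : 0 ≤ k.re := (abs_nonneg _).trans hk
  rw [boundaryExt, norm_mul]
  have e1 : ‖((R : ℂ) ^ 2 / 4)‖ = R ^ 2 / 4 := by
    rw [norm_div, norm_pow, Complex.norm_real, Real.norm_of_nonneg hR]; simp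
  have hk2 : ‖k‖ ^ 2 ≤ 2 * k.re ^ 2 := by
    rw [← Complex.normSq_eq_norm_sq, Complex.normSq_apply]
    have : k.im ^ 2 ≤ k.re ^ 2 := sq_le_sq' (by linarith [(abs_le.1 hk).1]) (abs_le.1 hk).2
    nlinarith
  have hb : ∀ s : Metric.sphere (0 : E3) 1, ‖boundaryDensity f k (R • (s : E3))‖ ≤
      4 * (potConst R * Q * Real.exp (k.re * (R + R))) ^ 2 * (1 + 2 * k.re ^ 2) := fun s => by
    have hx : ‖R • (s : E3)‖ ≤ R := by
      rw [norm_smul, Real.norm_of_nonneg hR]; simp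
    refine (norm_boundaryDensity_le hf2 hf hR hQ hfQ hx ha hk (by linarith)).trans ?_
    gcongr
  have hint := norm_integral_le_of_norm_le_const (μ := (volume : Measure E3).toSphere)
    (Eventually.of_forall hb)
  rw [e1]
  calc _ ≤ R ^ 2 / 4 * (4 * (potConst R * Q * Real.exp (k.re * (R + R))) ^ 2
        * (1 + 2 * k.re ^ 2) * sphereArea) := by gcongr; exact hint
    _ = _ := by
      rw [mul_pow _ (Real.exp _), ← Real.exp_nat_mul]
      have : ((2 : ℕ) : ℝ) * (k.re * (R + R)) = 4 * R * k.re := by push_cast; ring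
      rw [this]
      ring

lemma differentiable_boundaryExt (hf2 : MemLp f 2 volume)
    (hf : Function.support f ⊆ Metric.closedBall 0 R) (hR : 0 ≤ R) (hQ : 0 < Q)
    (hfQ : ∫ y, f y ^ 2 ≤ Q ^ 2) : Differentiable ℂ (boundaryExt R f) := by
  unfold boundaryExt
  refine (differentiable_const _).mul (differentiable_integral_of_bound (fun k => ?_) (fun s => ?_)
    fun r => ?_)
  · have hm : ∀ l : ℂ, StronglyMeasurable fun s : Metric.sphere (0 : E3) 1 =>
        pot f (R • (s : E3)) l := fun l =>
      (stronglyMeasurable_pot hf2 l).comp_measurable (measurable_subtype_coe.const_smul R)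
    unfold boundaryDensity
    exact ((((hm _).sub (hm _)).mul ((hm _).sub (hm _))).add (stronglyMeasurable_const.mul
      (((hm _).add (hm _)).mul ((hm _).add (hm _))))).aestronglyMeasurable
  · have hd := differentiable_pot hf2 hf (R • (s : E3))
    have d1 : Differentiable ℂ fun k : ℂ => pot f (R • (s : E3)) (Complex.I * k) :=
      hd.comp (by fun_prop)
    have d2 : Differentiable ℂ fun k : ℂ => pot f (R • (s : E3)) (-(Complex.I * k)) :=
      hd.comp (by fun_prop)
    have d3 : Differentiable ℂ fun k : ℂ => pot f (R • (s : E3)) (-k) := hd.comp (by fun_prop)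
    unfold boundaryDensity
    fun_prop
  · refine ⟨fun _ => 4 * (potConst R * Q * Real.exp (max r 0 * (R + R))) ^ 2 * (1 + (max r 0) ^ 2),
      integrable_const _, fun k hk s => ?_⟩
    have hx : ‖R • (s : E3)‖ ≤ R := by
      rw [norm_smul, Real.norm_of_nonneg hR]; simp
    have hk' : ‖k‖ ≤ max r 0 := hk.trans (le_max_left _ _)
    refine (norm_boundaryDensity_le hf2 hf hR hQ hfQ hx (le_max_right r 0)
      ((Complex.abs_im_le_norm k).trans hk')
      ((neg_le_abs _).trans ((Complex.abs_re_le_norm k).trans hk'))).trans ?_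
    beta_reduce
    gcongr

/-- The bound of the damped boundary data in the sector is `sectorConst R * Q ^ 2`. -/
noncomputable def sectorConst (R : ℝ) : ℝ :=
  R ^ 2 * sphereArea * potConst R ^ 2 * (1 + 1 / R ^ 2)

lemma sectorConst_nonneg (hR : 0 ≤ R) : 0 ≤ sectorConst R := by
  have : 0 ≤ sphereArea := measureReal_nonneg
  have := potConst_nonneg hR
  unfold sectorConst
  positivity

lemma norm_exp_mul_boundaryExt_le (hf2 : MemLp f 2 volume)
    (hf : Function.support f ⊆ Metric.closedBall 0 R) (hR : 0 < R) (hQ : 0 < Q)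
    (hfQ : ∫ y, f y ^ 2 ≤ Q ^ 2) {k : ℂ} (hk : |k.im| ≤ k.re) :
    ‖Complex.exp (-(6 * R * k)) * boundaryExt R f k‖ ≤ sectorConst R * Q ^ 2 := by
  have ha : 0 ≤ k.re := (abs_nonneg _).trans hk
  have hA : 0 ≤ sphereArea := measureReal_nonneg
  rw [norm_mul, Complex.norm_exp]
  have e1 : (-(6 * R * k) : ℂ).re = -(6 * R * k.re) := by
    have : (6 * R * k : ℂ) = ((6 * R : ℝ) : ℂ) * k := by push_cast; ring
    rw [Complex.neg_re, this, Complex.re_ofReal_mul]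
  rw [e1]
  -- The rate `6R` leaves a surplus `e^{-2R Re k}` over the growth of the potentials, which absorbs
  -- the polynomial factor.
  have h1 : Real.exp (-(6 * R * k.re)) * (Real.exp (4 * R * k.re) * (1 + 2 * k.re ^ 2))
      ≤ 1 + 1 / R ^ 2 := by
    rw [← mul_assoc, ← Real.exp_add]
    have e2 : -(6 * R * k.re) + 4 * R * k.re = -(2 * R * k.re) := by ring
    rw [e2, Real.exp_neg, inv_mul_le_iff₀ (Real.exp_pos _)]
    have h2 := Real.quadratic_le_exp_of_nonneg (x := 2 * R * k.re) (by positivity)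
    have h3 : 1 + 2 * R ^ 2 * k.re ^ 2 ≤ Real.exp (2 * R * k.re) := by
      have : 0 ≤ 2 * R * k.re := by positivity
      nlinarith
    calc 1 + 2 * k.re ^ 2 ≤ (1 + 2 * R ^ 2 * k.re ^ 2) * (1 + 1 / R ^ 2) := by
          have : (1 + 2 * R ^ 2 * k.re ^ 2) * (1 + 1 / R ^ 2)
              = 1 + 2 * k.re ^ 2 + (1 / R ^ 2 + 2 * R ^ 2 * k.re ^ 2) := by field_simp; ring
          rw [this]
          have : 0 ≤ 1 / R ^ 2 + 2 * R ^ 2 * k.re ^ 2 := by positivity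
          linarith
      _ ≤ _ := by gcongr
  calc _ ≤ Real.exp (-(6 * R * k.re)) * (R ^ 2 * sphereArea * (potConst R * Q) ^ 2
      * (Real.exp (4 * R * k.re) * (1 + 2 * k.re ^ 2))) := by
        gcongr
        exact norm_boundaryExt_le hf2 hf hR.le hQ hfQ hk
    _ = R ^ 2 * sphereArea * (potConst R * Q) ^ 2 * (Real.exp (-(6 * R * k.re))
      * (Real.exp (4 * R * k.re) * (1 + 2 * k.re ^ 2))) := by ring
    _ ≤ R ^ 2 * sphereArea * (potConst R * Q) ^ 2 * (1 + 1 / R ^ 2) := by gcongr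
    _ = _ := by rw [sectorConst]; ring

lemma integral_sq_le_of_eLpNorm_le (hf2 : MemLp f 2 volume)
    (hf : Function.support f ⊆ Metric.closedBall 0 R) (hQ : 0 ≤ Q)
    (h : eLpNorm f 2 (volume.restrict (Metric.closedBall 0 R)) ≤ ENNReal.ofReal Q) :
    ∫ y, f y ^ 2 ≤ Q ^ 2 := by
  rw [eLpNorm_restrict_eq_of_support_subset hf,
    hf2.eLpNorm_eq_integral_rpow_norm (by norm_num) (by norm_num)] at h
  have h1 := (ENNReal.ofReal_le_ofReal_iff hQ).1 h
  have h2 : ∀ y, ‖f y‖ ^ (2 : ENNReal).toReal = f y ^ 2 := fun y => by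
    simp
  simp only [h2] at h1
  have h3 : 0 ≤ ∫ y, f y ^ 2 := integral_nonneg fun y => sq_nonneg _
  have h4 : ((∫ y, f y ^ 2) ^ ((2 : ENNReal).toReal)⁻¹) ^ 2 = ∫ y, f y ^ 2 := by
    have : ((2 : ENNReal).toReal)⁻¹ = 1 / 2 := by simp
    rw [this, ← Real.sqrt_eq_rpow, Real.sq_sqrt h3]
  rw [← h4]
  gcongr

lemma boundaryData_nonneg (R : ℝ) (u : ℝ → E3 → ℂ) (κ : ℝ) : 0 ≤ boundaryData R u κ := by
  have : ∀ g : E3 → ℂ, 0 ≤ sphereNormSq R g := fun g =>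
    mul_nonneg (sq_nonneg _) (integral_nonneg fun _ => sq_nonneg _)
  have h1 := this (u κ)
  have h2 := this (Δ (u κ))
  unfold boundaryData
  positivity

end BoundaryData

/-! ### The stability estimate. -/

theorem mainTheorem8 (R ε A : ℝ) (hR : 0 < R) (hε : 0 < ε) (hA : 0 < A) :
    ∃ β : ℝ → ℝ,
      (∀ κ ∈ Set.Ioo (A + ε) (ε + (2 : ℝ) ^ (1 / 4 : ℝ) * A), 1 / 2 ≤ β κ) ∧
      (∀ κ ∈ Set.Ioi (ε + (2 : ℝ) ^ (1 / 4 : ℝ) * A),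
        1 / Real.pi * (((κ - ε) / A) ^ 4 - 1) ^ (-(1 / 2) : ℝ) ≤ β κ) ∧
      ∀ Q₀ : ℝ, 0 < Q₀ → ∃ C : ℝ, 0 < C ∧
        ∀ Q : ℝ, Q₀ ≤ Q →
        ∀ f : E3 → ℝ, MemLp f 2 volume → Function.support f ⊆ Metric.closedBall 0 R →
          eLpNorm f 2 (volume.restrict (Metric.closedBall 0 R)) ≤ ENNReal.ofReal Q →
        ∀ u : ℝ → E3 → ℂ, (∀ κ : ℝ, 0 < κ → IsScatteringSolution f κ (u κ)) →
          BddAbove (boundaryData R u '' Set.Ioo ε (A + ε)) ∧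
          ∀ κ ∈ Set.Ioi (A + ε),
            boundaryData R u κ ≤
              C * Q ^ 2 * Real.exp (6 * R * κ) * dataLevel R u ε (A + ε) ^ (2 * β κ) := by
  refine ⟨sectorExponent ε A, fun κ hκ => half_le_sectorExponent hA hκ,
    fun κ hκ => rpow_le_sectorExponent hA hκ, fun Q₀ hQ₀ => ?_⟩
  have hC0 := sectorConst_nonneg hR.le
  -- The second summand makes `C Q² ≥ 1`, so that `M ^ (1 - β) ≤ max 1 M ≤ C Q²` holds uniformly in
  -- `β ∈ (0, 1]`.
  refine ⟨sectorConst R + (Q₀ ^ 2)⁻¹, by positivity, fun Q hQ f hf2 hf hfn u hu => ?_⟩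
  have hQ0 : 0 < Q := hQ₀.trans_le hQ
  have hfQ := integral_sq_le_of_eLpNorm_le hf2 hf hQ0.le hfn
  set J : ℂ → ℂ := fun k => Complex.exp (-(6 * R * k)) * boundaryExt R f k with hJ
  set M := sectorConst R * Q ^ 2 with hM
  have hM0 : 0 ≤ M := by positivity
  have hJd : Differentiable ℂ J := by
    have := differentiable_boundaryExt hf2 hf hR.le hQ0 hfQ
    fun_prop
  have hJM : ∀ k : ℂ, |k.im| ≤ k.re → ‖J k‖ ≤ M := fun k hk =>
    norm_exp_mul_boundaryExt_le hf2 hf hR hQ0 hfQ hk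
  have hJr : ∀ κ : ℝ, 0 < κ → boundaryData R u κ = Real.exp (6 * R * κ) * ‖J κ‖ := by
    intro κ hκ
    have e : (-(6 * R * κ) : ℂ) = ((-(6 * R * κ) : ℝ) : ℂ) := by push_cast; ring
    rw [hJ]
    simp only
    rw [boundaryExt_eq hκ hf2 hf (hu κ hκ), norm_mul, e, ← Complex.ofReal_exp, Complex.norm_real,
      Complex.norm_real, Real.norm_of_nonneg (Real.exp_pos _).le,
      Real.norm_of_nonneg (boundaryData_nonneg R u κ), ← mul_assoc, ← Real.exp_add]
    simp
  have hbdd : BddAbove (boundaryData R u '' Set.Ioo ε (A + ε)) := by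
    refine ⟨Real.exp (6 * R * (A + ε)) * M, ?_⟩
    rintro _ ⟨κ, hκ, rfl⟩
    have hκ0 : 0 < κ := hε.trans hκ.1
    rw [hJr κ hκ0]
    have := hJM κ (by simpa using hκ0.le)
    have := hκ.2.le
    gcongr
  refine ⟨hbdd, fun κ hκ => ?_⟩
  have hκ : A + ε < κ := hκ
  set S := sSup (boundaryData R u '' Set.Ioo ε (A + ε)) with hS
  have hS0 : 0 ≤ S := Real.sSup_nonneg fun x ⟨t, _, ht⟩ => ht ▸ boundaryData_nonneg R u t
  set β := sectorExponent ε A κ with hβ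
  have hβ1 : β ≤ 1 := sectorExponent_le_one
  have hβ0 : 0 < β := sectorExponent_pos hA hκ
  have hJS : ∀ t ∈ Set.Ioo ε (A + ε), ‖J (t : ℂ)‖ ≤ S := by
    intro t ht
    have ht0 : 0 < t := hε.trans ht.1
    have h1 : boundaryData R u t ≤ S := le_csSup hbdd ⟨t, ht, rfl⟩
    rw [hJr t ht0] at h1
    have h2 : 1 ≤ Real.exp (6 * R * t) := Real.one_le_exp (by positivity)
    nlinarith [norm_nonneg (J (t : ℂ))]
  have hmain := norm_le_of_bound_on_slit hε hA hκ hJd hJM hJS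
  -- `dataLevel` is the square root of the supremum, which accounts for the exponent `2β`.
  have hlevel : dataLevel R u ε (A + ε) ^ (2 * β) = S ^ β := by
    rw [dataLevel, ← hS, Real.sqrt_eq_rpow, ← Real.rpow_mul hS0]
    congr 1
    ring
  have hMle : M ^ (1 - β) ≤ (sectorConst R + (Q₀ ^ 2)⁻¹) * Q ^ 2 := by
    rw [add_mul]
    have h2 : 1 ≤ (Q₀ ^ 2)⁻¹ * Q ^ 2 := by
      rw [inv_mul_eq_div, one_le_div (by positivity)]
      gcongr
    rcases le_total M 1 with h | h
    · have := Real.rpow_le_one hM0 h (by linarith : 0 ≤ 1 - β)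
      linarith
    · have := Real.rpow_le_rpow_of_exponent_le h (by linarith : 1 - β ≤ 1)
      rw [Real.rpow_one] at this
      linarith
  rw [hlevel, hJr κ (by linarith)]
  calc Real.exp (6 * R * κ) * ‖J κ‖ ≤ Real.exp (6 * R * κ) * (M ^ (1 - β) * S ^ β) := by gcongr
    _ ≤ Real.exp (6 * R * κ) * (((sectorConst R + (Q₀ ^ 2)⁻¹) * Q ^ 2) * S ^ β) := by gcongr
    _ = _ := by ring
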